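/- Fix $n\ge 0$ and let $\rho=[n-1,\dots,1,0]$. For partitions $\lambda\le\rho$ (that is, $\lambda_i\le n-i$ for $i=1,\dots,n$) define the following two families of polynomials, in $\mathbb{Q}[x_1,\dots,x_{2n}]$ and $\mathbb{Q}[a_1,\dots,a_{2n}]$ respectively; $s_i$ denotes the exchange of the $i$-th and $(i+1)$-st variables. (1) Label the box in row $r$ and column $c$ ($r,c\ge 1$, row $1$ being the longest) of the diagram of $\lambda$ by the pair $[i,k]$, where $i=n+c-r$, and where $k$ is the number of times all corners of the diagram must be erased before the box becomes a corner. Then $KL^x_\lambda$ is the image of $x_1x_2\cdots x_n$ under the operators $s_i+\frac{1}{1+k}$, applied successively for the boxes of $\lambda$ read row by row from row $1$, each row from left to right. (2) $LK^a_\rho=(a_1-a_2)(a_3-a_4)\cdots(a_{2n-1}-a_{2n})$, and if $\nu$ is obtained from $\lambda\le\rho$ by removing one corner box, with first label $i$, then $LK^a_\nu=(s_i-1)\,LK^a_\lambda$. Let $(f,g)$ be the pairing which is linear in $g$ and satisfies $(f,x^v)=f(v_1,\dots,v_{2n})$ for every monomial $x^v$, $v\in\mathbb{N}^{2n}$. The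 rule (2) is consistent (the result does not depend on the order in which boxes are removed), and $LK^a_\lambda$ is the link-pattern product $\prod (a_i-a_j)$ over the pairs $i<j$ of matched parentheses in the word of length $2n$ in $1$ (opening) and $0$ (closing) whose letters $1$ stand in the positions $k+\lambda_{n+1-k}$, $k=1,\dots,n$. Moreover, for all partitions $\lambda,\mu\le\rho$, $$ (LK^a_\lambda,\, KL^x_\mu)=\delta_{\lambda,\mu}. $$ -/

import Mathlib

namespace HankelKL

instance : DecidableEq YoungDiagram := fun a b =>
  decidable_of_iff (a.cells = b.cells) YoungDiagram.ext_iff.symm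

/-- The staircase `ρ = [n-1, ..., 1, 0]`, as a Young diagram (boxes `(row, column)` from `0`). -/
def staircase (n : ℕ) : YoungDiagram where
  cells := (Finset.range n ×ˢ Finset.range n).filter fun c => c.1 + c.2 + 1 < n
  isLowerSet := by
    rintro ⟨a, b⟩ ⟨c, d⟩ ⟨h1, h2⟩ h
    simp only [Finset.coe_filter, Finset.mem_product, Finset.mem_range, Set.mem_ofPred_eq] at *
    omega

/-- The first label of a box: it is `n` for the first box, increases by `1` rightwards and
decreases by `1` downwards (it is only used for boxes of `staircase n`, where `c.1 < n`). -/
def label (n : ℕ) (c : ℕ × ℕ) : ℕ := n + c.2 - c.1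

/-- `c` is a corner of `lam`. -/
def IsCorner (lam : YoungDiagram) (c : ℕ × ℕ) : Prop :=
  c ∈ lam ∧ (c.1 + 1, c.2) ∉ lam ∧ (c.1, c.2 + 1) ∉ lam

/-- The diagram obtained from `lam` by erasing all its corners. -/
def peel (lam : YoungDiagram) : YoungDiagram where
  cells := lam.cells.filter fun c => (c.1 + 1, c.2) ∈ lam ∨ (c.1, c.2 + 1) ∈ lam
  isLowerSet := by
    rintro ⟨a, b⟩ ⟨c, d⟩ ⟨h1, h2⟩ h
    simp only [Finset.coe_filter, YoungDiagram.mem_cells, Set.mem_ofPred_eq] at *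
    refine ⟨lam.up_left_mem h1 h2 h.1, ?_⟩
    rcases h.2 with h' | h'
    · exact Or.inl (lam.up_left_mem (Nat.succ_le_succ h1) h2 h')
    · exact Or.inr (lam.up_left_mem h1 (Nat.succ_le_succ h2) h')

/-- The second label of a box `c` of `lam`: the number of times the corners have to be erased
before `c` becomes a corner. -/
noncomputable def level (lam : YoungDiagram) (c : ℕ × ℕ) : ℕ :=
  sInf {k | IsCorner (peel^[k] lam) c}

/-- The boxes of `lam`, read by successive rows, each row from left to right. -/
def rowReading (lam : YoungDiagram) : List (ℕ × ℕ) :=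
  (List.range (lam.colLen 0)).flatMap fun i => (List.range (lam.rowLen i)).map fun j => (i, j)

/-- Polynomials with rational coefficients; the variables are indexed from `1`, so that `X i` is
`x_i` (or `a_i`). Only the variables of index `1, ..., 2n` occur below. -/
abbrev Poly := MvPolynomial ℕ ℚ

/-- The action of the simple transposition `s_i`, exchanging the variables `i` and `i + 1`. -/
noncomputable def simpleAct (i : ℕ) (f : Poly) : Poly :=
  MvPolynomial.rename (Equiv.swap i (i + 1)) f

/-- `KL^x_lam`: the image of `x_1 ⋯ x_n` under the bi-labelled diagram of `lam` read by
successive rows, a box labelled `[i, k]` acting as `s_i + 1 / (1 + k)`. -/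
noncomputable def KLx (n : ℕ) (lam : YoungDiagram) : Poly :=
  (rowReading lam).foldl
    (fun f c => simpleAct (label n c) f + MvPolynomial.C (1 / (1 + (level lam c : ℚ))) * f)
    (∏ i ∈ Finset.Icc 1 n, MvPolynomial.X i)

/-- `IsLKa n lam f`: the polynomial `f` is obtained at the vertex `lam` by following the reversed
graph, starting with `(a_1 - a_2)(a_3 - a_4) ⋯ (a_{2n-1} - a_{2n})` at the staircase, an edge
that removes a box of first label `i` acting as `s_i - 1`. -/
inductive IsLKa (n : ℕ) : YoungDiagram → Poly → Prop
  | base : IsLKa n (staircase n)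
      (∏ k ∈ Finset.range n, (MvPolynomial.X (2 * k + 1) - MvPolynomial.X (2 * k + 2)))
  | step {lam mu : YoungDiagram} {f : Poly} {c : ℕ × ℕ} (hf : IsLKa n lam f)
      (hc : c ∉ mu) (hlam : lam.cells = insert c mu.cells) :
      IsLKa n mu (simpleAct (label n c) f - f)

/-- The positions in `1, ..., 2n` of the letters `1` of the Yamanouchi word of `lam` (its
increasing steps): `k + lam_{n+1-k}` for `k = 1, ..., n`. -/
def upSteps (n : ℕ) (lam : YoungDiagram) : Finset ℕ :=
  (Finset.range n).image fun i => n - i + lam.rowLen i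

/-- The height of the Dyck path of `lam` after `k` steps. -/
def height (n : ℕ) (lam : YoungDiagram) (k : ℕ) : ℤ :=
  ∑ p ∈ Finset.Icc 1 k, if p ∈ upSteps n lam then 1 else -1

/-- Positions `i < j` are linked: `i` carries an opening parenthesis, and `j` is the closing one
matched with it, i.e. the path first returns at step `j` to its height before step `i`. -/
def Linked (n : ℕ) (lam : YoungDiagram) (i j : ℕ) : Prop :=
  i < j ∧ i ∈ upSteps n lam ∧ height n lam j = height n lam (i - 1) ∧
    ∀ k ∈ Finset.Ico i j, height n lam (i - 1) < height n lam k

instance (n : ℕ) (lam : YoungDiagram) (i j : ℕ) : Decidable (Linked n lam i j) := by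
  unfold Linked; infer_instance

/-- The link-pattern product: the product of the factors `a_i - a_j` over the links of `lam`. -/
noncomputable def linkProduct (n : ℕ) (lam : YoungDiagram) : Poly :=
  ∏ p ∈ (Finset.Icc 1 (2 * n) ×ˢ Finset.Icc 1 (2 * n)).filter (fun p => Linked n lam p.1 p.2),
    (MvPolynomial.X p.1 - MvPolynomial.X p.2)

/-- The pairing, linear in `g`, for which `(f, x^v)` is the value of `f` at the exponent
vector `v`. -/
noncomputable def pairing (f g : Poly) : ℚ :=
  ∑ v ∈ g.support, g.coeff v * MvPolynomial.eval (fun i => (v i : ℚ)) f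

end HankelKL

/-! Every monomial of `KLx n mu` is squarefree, so the pairing sees a polynomial `f` only through
its values on words in 0 and 1. Transpositions are self-adjoint for the pairing; moving all the
operators onto `f` turns `f ↦ (f, KL_mu)` into a functional `φ` on functions of words: apply a
product of operators `s_i + 1/(1+k)`, then evaluate at the word `1^n 0^n` of the empty diagram.
Corners of a diagram are the factors `01` (valleys) of its word, and erasing all corners replaces
each `01` by `10`. Boxes with adjacent labels are comparable, and levels decrease strictly along the
order of boxes; hence the row reading may be rearranged level by level, which gives the layered
functional `IsFusion`.

Two properties of the layered functional carry the duality. First, for the initial parameter 1 it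
vanishes on the image of `s_j - 1` unless the word has a peak `10` at `j`
(`IsFusion.tl_eq_zero_of_not_peak`). At a valley this is `(s + 1)(s - 1) = 0`. At two equal letters,
Yang-Baxter carries the factor `s_j - 1` through one layer after another. Second, at a peak `p`,
evaluating on `(a_p - a_{p+1}) f` gives the functional of the word without this peak, evaluated on
`f` (`IsFusion.cup`). The induction over layers also needs the value at a valley inside `1010`,
where a scalar `1/t - 1` appears.

A link-pattern product is built by inserting factors `10`, each contributing some `a_p - a_{p+1}`.
Since such a product is antisymmetric in `p, p+1`, it lies in the image of `s_p - 1`. If the word of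
`mu` has no peak at `p`, the pairing is therefore zero; if it has one, the peak is contracted and
induction on `n` applies (`IsLink.duality`).

That the recursion by `s_i - 1` yields link-pattern products is the Plücker relation: removing a box
labelled `i` replaces the links `(a,i), (i+1,b)` by `(i,i+1), (a,b)`. It is used in the form
`IsLink.tl` on words and in the form `linkProduct_insert` on polynomials, where it also gives
consistency. -/

namespace HankelKL

/-! ### Operators on functions of words -/

/-- Words in `1` and `0`, indexed by `ℤ`. -/
abbrev Word := ℤ → Bool

/-- Functions on words. -/
abbrev WordFun := Word → ℚ

/-- Exchange of the letters in positions `i` and `i + 1`. -/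
def swapAt (i : ℤ) (w : Word) : Word := fun k => w (Equiv.swap i (i + 1) k)

/-- Deletion of the letters in positions `p` and `p + 1`. -/
def del (p : ℤ) (w : Word) : Word := fun k => if k < p then w k else w (k + 2)

/-- Insertion of the letters `10` in positions `p` and `p + 1`. -/
def ins (p : ℤ) (w : Word) : Word := fun k =>
  if k < p then w k else if k = p then true else if k = p + 1 then false else w (k - 2)

/-- A letter as a rational number. -/
def bit (b : Bool) : ℚ := if b then 1 else 0

/-- The action of a simple transposition on functions. -/
def transp (i : ℤ) : Module.End ℚ WordFun := LinearMap.funLeft ℚ ℚ (swapAt i)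

/-- The operator `s_i + 1 / t`. -/
noncomputable def yb (t : ℚ) (i : ℤ) : Module.End ℚ WordFun := transp i + (1 / t) • 1

/-- The operator `s_i - 1`. -/
noncomputable def tl (i : ℤ) : Module.End ℚ WordFun := transp i - 1

/-- Multiplication by `a_p - a_{p+1}` of a function of the remaining letters. -/
def cup (p : ℤ) : Module.End ℚ WordFun where
  toFun f v := (bit (v p) - bit (v (p + 1))) * f (del p v)
  map_add' f g := by ext v; simp [mul_add]
  map_smul' c f := by ext v; simp [mul_left_comm]

theorem transp_apply (i : ℤ) (f : WordFun) (v : Word) : transp i f v = f (swapAt i v) := rfl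

theorem cup_apply (p : ℤ) (f : WordFun) (v : Word) :
    cup p f v = (bit (v p) - bit (v (p + 1))) * f (del p v) := rfl

theorem swapAt_apply (i : ℤ) (w : Word) (k : ℤ) :
    swapAt i w k = if k = i then w (i + 1) else if k = i + 1 then w i else w k := by
  unfold swapAt; rw [Equiv.swap_apply_def]; split_ifs <;> rfl

theorem swapAt_swapAt (i : ℤ) (w : Word) : swapAt i (swapAt i w) = w := by
  funext k; simp [swapAt]

/-! ### Coxeter and Yang-Baxter relations -/

theorem transp_mul_self (i : ℤ) : transp i * transp i = 1 := by
  ext f v; simp [transp_apply, swapAt_swapAt]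

theorem transp_commute {i j : ℤ} (h : i + 2 ≤ j ∨ j + 2 ≤ i) : Commute (transp i) (transp j) := by
  refine LinearMap.ext fun f => funext fun v => ?_
  simp only [Module.End.mul_apply, transp_apply]
  congr 1
  funext k
  simp only [swapAt_apply]
  grind

theorem transp_braid {i j : ℤ} (h : j = i + 1 ∨ i = j + 1) :
    transp i * transp j * transp i = transp j * transp i * transp j := by
  refine LinearMap.ext fun f => funext fun v => ?_
  simp only [Module.End.mul_apply, transp_apply]
  congr 1
  funext k
  simp only [swapAt_apply]
  grind

theorem yb_commute (s t : ℚ) {i j : ℤ} (h : i + 2 ≤ j ∨ j + 2 ≤ i) :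
    Commute (yb s i) (yb t j) := by
  unfold yb
  exact ((transp_commute h).add_right ((Commute.one_right _).smul_right _)).add_left
    (((Commute.one_left _).smul_left _))

theorem yb_commute_self (s t : ℚ) (i : ℤ) : Commute (yb s i) (yb t i) := by
  unfold yb
  exact ((Commute.refl _).add_right ((Commute.one_right _).smul_right _)).add_left
    (((Commute.one_left _).smul_left _))

theorem tl_eq_yb (i : ℤ) : tl i = yb (-1) i := by
  unfold tl yb; module

theorem yb_eq_tl (t : ℚ) (i : ℤ) : yb t i = tl i + (1 + 1 / t) • 1 := by
  unfold tl yb; rw [add_smul, one_smul]; abel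

theorem yang_baxter {a b : ℚ} (ha : a ≠ 0) (hb : b ≠ 0) (hab : a + b ≠ 0) {i j : ℤ}
    (h : j = i + 1 ∨ i = j + 1) :
    yb a i * yb (a + b) j * yb b i = yb b j * yb (a + b) i * yb a j := by
  have hs := transp_braid h
  have h1 := transp_mul_self i
  have h2 := transp_mul_self j
  unfold yb
  simp only [add_mul, mul_add, smul_mul_assoc, mul_smul_comm, one_mul, mul_one, h1, h2, hs]
  -- After the braid and involution relations, the two sides differ by a multiple of `transp i -
  -- transp j` whose coefficient is zero by this identity.
  have e : (1 / a) * (1 / b) = 1 / (a + b) * (1 / a) + 1 / (a + b) * (1 / b) := by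
    field_simp; ring
  simp only [smul_add, smul_smul]
  generalize 1 / a = x at *
  generalize 1 / b = y at *
  generalize 1 / (a + b) = z at *
  match_scalars <;> first | linear_combination e | linear_combination -e | ring1

theorem yb_one_mul_tl (i : ℤ) : yb 1 i * tl i = 0 := by
  unfold yb tl
  have := transp_mul_self i
  simp only [add_mul, mul_sub, this]
  simp [add_comm]

/-! ### Temperley-Lieb action on cups -/

theorem tl_cup_self (p : ℤ) (f : WordFun) : tl p (cup p f) = (-2 : ℚ) • cup p f := by
  funext v
  simp only [tl, LinearMap.sub_apply, Module.End.one_apply, Pi.sub_apply, transp_apply, cup_apply,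
    Pi.smul_apply, smul_eq_mul]
  have : del p (swapAt p v) = del p v := by
    funext k; simp only [del, swapAt_apply]; grind
  rw [this]; simp [swapAt_apply]; ring

/-- A function of one Boolean letter is affine in its bit, and for affine dependence this is a
three-term relation. It would fail for letters with more than two values; the proof checks the eight
cases. -/
theorem tl_cup_left (p : ℤ) (f : WordFun) : tl (p - 1) (cup p f) = cup (p - 1) f := by
  funext v
  simp only [tl, LinearMap.sub_apply, Module.End.one_apply, Pi.sub_apply, transp_apply, cup_apply]
  have h1 : v (p - 1) = v p → del p (swapAt (p - 1) v) = del p v := by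
    intro h; funext k; simp only [del, swapAt_apply]; grind
  have h2 : v (p + 1) = v p → del p (swapAt (p - 1) v) = del (p - 1) v := by
    intro h; funext k; simp only [del, swapAt_apply]; grind
  have h3 : v (p - 1) = v (p + 1) → del p v = del (p - 1) v := by
    intro h; funext k; simp only [del]; grind
  have e1 : swapAt (p - 1) v p = v (p - 1) := by simp only [swapAt_apply]; grind
  have e2 : swapAt (p - 1) v (p + 1) = v (p + 1) := by simp only [swapAt_apply]; grind
  rw [e1, e2, sub_add_cancel]
  cases ha : v (p - 1) <;> cases hb : v p <;> cases hc : v (p + 1) <;> simp_all [bit]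

theorem tl_cup_right (p : ℤ) (f : WordFun) : tl (p + 1) (cup p f) = cup (p + 1) f := by
  funext v
  simp only [tl, LinearMap.sub_apply, Module.End.one_apply, Pi.sub_apply, transp_apply, cup_apply]
  have h1 : v (p + 1) = v (p + 2) → del p (swapAt (p + 1) v) = del p v := by
    intro h; funext k; simp only [del, swapAt_apply]; grind
  have h2 : v p = v (p + 1) → del p (swapAt (p + 1) v) = del (p + 1) v := by
    intro h; funext k; simp only [del, swapAt_apply]; grind
  have h3 : v p = v (p + 2) → del p v = del (p + 1) v := by
    intro h; funext k; simp only [del]; grind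
  have e1 : swapAt (p + 1) v p = v p := by simp only [swapAt_apply]; grind
  have e2 : swapAt (p + 1) v (p + 1) = v (p + 2) := by simp only [swapAt_apply]; grind
  rw [e1, e2, show p + 1 + 1 = p + 2 by ring]
  cases ha : v p <;> cases hb : v (p + 1) <;> cases hc : v (p + 2) <;> simp_all [bit]

theorem transp_cup_of_lt {i p : ℤ} (h : i + 2 ≤ p) (f : WordFun) :
    transp i (cup p f) = cup p (transp i f) := by
  funext v
  simp only [transp_apply, cup_apply]
  have : del p (swapAt i v) = swapAt i (del p v) := by
    funext k; simp only [del, swapAt_apply]; grind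
  rw [this]
  congr 2 <;> simp only [swapAt_apply] <;> grind

theorem transp_cup_of_gt {i p : ℤ} (h : p + 2 ≤ i) (f : WordFun) :
    transp i (cup p f) = cup p (transp (i - 2) f) := by
  funext v
  simp only [transp_apply, cup_apply]
  have : del p (swapAt i v) = swapAt (i - 2) (del p v) := by
    funext k; simp only [del, swapAt_apply]; grind
  rw [this]
  congr 2 <;> simp only [swapAt_apply] <;> grind

/-! ### Peaks, valleys and layers of commuting operators -/

/-- `w` has letters `01` in positions `i` and `i + 1`. -/
def Valley (w : Word) (i : ℤ) : Prop := w i = false ∧ w (i + 1) = true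

/-- `w` has letters `10` in positions `i` and `i + 1`. -/
def Peak (w : Word) (i : ℤ) : Prop := w i = true ∧ w (i + 1) = false

/-- The word obtained by replacing all factors `01` by `10`. -/
def wordPeel (w : Word) : Word := fun k => if w k then w (k - 1) else w (k + 1)

/-- The word obtained by replacing the factors `10` in the positions of `S` by `01`. -/
def flip (S : List ℤ) (w : Word) : Word := fun k =>
  if k ∈ S then false else if k - 1 ∈ S then true else w k

/-- The product of the operators `s_i + 1 / t` for `i` in `S`. -/
noncomputable def layer (t : ℚ) (S : List ℤ) : Module.End ℚ WordFun := (S.map (yb t)).prod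

/-- The positions in `S` are at mutual distance at least two. -/
def Far (S : List ℤ) : Prop := S.Pairwise fun i j => i + 2 ≤ j ∨ j + 2 ≤ i

theorem Far.nodup {S : List ℤ} (h : Far S) : S.Nodup :=
  List.Pairwise.imp (fun h => by rintro rfl; omega) h

theorem far_of_nodup {S : List ℤ} (h : S.Nodup)
    (hS : ∀ i ∈ S, ∀ j ∈ S, i ≠ j → i + 2 ≤ j ∨ j + 2 ≤ i) : Far S :=
  h.pairwise_of_forall_ne hS

theorem far_of_valleys {S : List ℤ} {w : Word} (h : S.Nodup) (hS : ∀ i ∈ S, Valley w i) :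
    Far S := by
  refine far_of_nodup h fun i hi j hj hij => ?_
  have h1 := hS i hi
  have h2 := hS j hj
  unfold Valley at h1 h2
  grind

theorem far_of_peaks {S : List ℤ} {w : Word} (h : S.Nodup) (hS : ∀ i ∈ S, Peak w i) :
    Far S := by
  refine far_of_nodup h fun i hi j hj hij => ?_
  have h1 := hS i hi
  have h2 := hS j hj
  unfold Peak at h1 h2
  grind

theorem layer_nil (t : ℚ) : layer t [] = 1 := rfl

theorem layer_cons (t : ℚ) (i : ℤ) (S : List ℤ) : layer t (i :: S) = yb t i * layer t S := by
  simp [layer]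

theorem layer_append (t : ℚ) (S S' : List ℤ) : layer t (S ++ S') = layer t S * layer t S' := by
  simp [layer]

theorem layer_perm (t : ℚ) {S S' : List ℤ} (h : Far S) (hp : S.Perm S') :
    layer t S = layer t S' := by
  refine (hp.map (yb t)).prod_eq' (List.pairwise_map.2 ?_)
  exact h.imp fun h => yb_commute t t h

theorem commute_layer (t : ℚ) {S : List ℤ} {x : Module.End ℚ WordFun}
    (h : ∀ i ∈ S, Commute x (yb t i)) : Commute x (layer t S) := by
  refine Commute.list_prod_right _ _ ?_
  simpa using h

theorem yb_commute_layer (s t : ℚ) {S : List ℤ} {j : ℤ}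
    (h : ∀ i ∈ S, i + 2 ≤ j ∨ j + 2 ≤ i) : Commute (yb s j) (layer t S) :=
  commute_layer t fun i hi => yb_commute s t (h i hi).symm

theorem tl_commute_layer (t : ℚ) {S : List ℤ} {j : ℤ}
    (h : ∀ i ∈ S, i + 2 ≤ j ∨ j + 2 ≤ i) : Commute (tl j) (layer t S) := by
  rw [tl_eq_yb]; exact yb_commute_layer _ t h

/-- A layer with one operator brought to the right end. -/
theorem layer_eq_erase_mul (t : ℚ) {S : List ℤ} (h : Far S) {j : ℤ} (hj : j ∈ S) :
    layer t S = layer t (S.erase j) * yb t j := by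
  have hp : S.Perm (S.erase j ++ [j]) :=
    (List.perm_cons_erase hj).trans (List.perm_append_singleton j _).symm
  rw [layer_perm t h hp, layer_append, layer_cons, layer_nil, mul_one]

theorem Far.erase {S : List ℤ} (h : Far S) (j : ℤ) : Far (S.erase j) :=
  List.Pairwise.sublist List.erase_sublist h

theorem Far.mem_erase {S : List ℤ} (h : Far S) {i j : ℤ} : i ∈ S.erase j ↔ i ≠ j ∧ i ∈ S :=
  h.nodup.mem_erase_iff

/-- `φ` is the functional `f ↦ (f, g)`, where `g` is obtained from the monomial of the maximal
word by the operators of the successive layers of `w`, with the parameters `t`, `t + 1`, ...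
from the outermost layer inwards. -/
inductive IsFusion : ℚ → Word → (WordFun →ₗ[ℚ] ℚ) → Prop
  | base {t : ℚ} {w : Word} (hw : ∀ i, ¬ Valley w i) : IsFusion t w (LinearMap.proj w)
  | step {t : ℚ} {w : Word} {φ : WordFun →ₗ[ℚ] ℚ} (hφ : IsFusion (t + 1) (wordPeel w) φ)
      {S : List ℤ} (hS : S.Nodup) (hmem : ∀ i, i ∈ S ↔ Valley w i) :
      IsFusion t w (φ ∘ₗ layer t S)

theorem peak_wordPeel {w : Word} {i : ℤ} (h : Valley w i) : Peak (wordPeel w) i := by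
  unfold Valley at h; unfold Peak wordPeel; grind

theorem flip_wordPeel {w : Word} {S : List ℤ} (hmem : ∀ i, i ∈ S ↔ Valley w i) :
    flip S (wordPeel w) = w := by
  funext k
  simp only [flip, hmem, wordPeel, Valley]
  grind

theorem wordPeel_eq_self {w : Word} (hw : ∀ i, ¬ Valley w i) : wordPeel w = w := by
  funext k
  have h1 := hw k
  have h2 := hw (k - 1)
  unfold Valley at h1 h2; unfold wordPeel; grind

/-- A word without valleys is fixed by peeling and admits further empty layers, which act trivially.
They are needed because contracting a peak can remove the last valley while the original word still
has a layer. -/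
theorem IsFusion.eq_proj {t : ℚ} {w : Word} {φ : WordFun →ₗ[ℚ] ℚ} (h : IsFusion t w φ)
    (hw : ∀ i, ¬ Valley w i) : φ = LinearMap.proj w := by
  induction h with
  | base _ => rfl
  | @step t w φ _ S _ hmem ih =>
    have hS : S = [] := List.eq_nil_iff_forall_not_mem.2 fun i hi => hw i ((hmem i).1 hi)
    rw [wordPeel_eq_self hw] at ih
    rw [ih hw, hS, layer_nil]; rfl

theorem IsFusion.unique {t : ℚ} {w : Word} {φ ψ : WordFun →ₗ[ℚ] ℚ} (h : IsFusion t w φ)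
    (h' : IsFusion t w ψ) : φ = ψ := by
  induction h generalizing ψ with
  | base hw => exact (h'.eq_proj hw).symm
  | @step t w φ hφ S hS hmem ih =>
    cases h' with
    | base hw => exact (IsFusion.step hφ hS hmem).eq_proj hw
    | @step _ _ ψ hψ S' hS' hmem' =>
      rw [ih hψ, layer_perm t (far_of_valleys hS fun i hi => (hmem i).1 hi)
        ((List.perm_ext_iff_of_nodup hS hS').2 fun i => by rw [hmem, hmem'])]

/-! ### Vanishing on the image of `s_j - 1` -/

theorem straight_flip {w : Word} {S : List ℤ} (hpk : ∀ i ∈ S, Peak w i) {j : ℤ}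
    (hj : flip S w j = flip S w (j + 1)) :
    j ∉ S ∧ ((j - 1 ∉ S ∧ j + 1 ∉ S ∧ w j = w (j + 1)) ∨
      (Valley w j ∧ ∃ k ∈ S, (k = j - 1 ∨ k = j + 1) ∧
        ∀ i ∈ S, i ≠ k → i + 2 ≤ j ∨ j + 2 ≤ i)) := by
  have hbd : ∀ i ∈ S, i ≠ j → i ≠ j - 1 → i ≠ j + 1 → i + 2 ≤ j ∨ j + 2 ≤ i := by
    intro i _ _ _ _; omega
  have h0 := hpk j
  have h1 := hpk (j - 1)
  have h2 := hpk (j + 1)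
  simp only [flip, add_sub_cancel_right] at hj
  simp only [Peak, sub_add_cancel] at h0 h1 h2
  unfold Valley
  grind

/-- Flipping back every position but `j` restores `w` except for its factor `01` at `j`, which stays
`10`. Thus `101` reads `110` and `010` reads `100`, with equal letters at `k` and `k + 1`. -/
theorem flip_erase_straight {w : Word} {S : List ℤ} (hS : S.Nodup) (hmem : ∀ i, i ∈ S ↔ Valley w i)
    {j k : ℤ} (hj : Valley w j) (hk : k = j - 1 ∨ k = j + 1) (hpk : Peak w k) :
    flip (S.erase j) (wordPeel w) k = flip (S.erase j) (wordPeel w) (k + 1) := by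
  simp only [flip, hS.mem_erase_iff, hmem, wordPeel, Valley] at *
  unfold Peak at hpk
  rcases hk with rfl | rfl <;> grind

/-- Invariance under the transpositions at the straight positions of a partially peeled word. -/
theorem IsFusion.layer_tl_eq_zero {u : ℚ} {w : Word} {φ : WordFun →ₗ[ℚ] ℚ}
    (h : IsFusion u w φ) (hu : 1 < u) {S : List ℤ} (hS : S.Nodup) (hpk : ∀ i ∈ S, Peak w i)
    {j : ℤ} (hj : flip S w j = flip S w (j + 1)) (f : WordFun) :
    φ (layer (u - 1) S (tl j f)) = 0 := by
  induction h generalizing S j f with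
  | @base u w hw =>
    obtain ⟨h0, ⟨h1, h2, h3⟩ | ⟨h1, -⟩⟩ := straight_flip hpk hj
    · have hc : Commute (tl j) (layer (u - 1) S) := tl_commute_layer _ (by grind)
      have hsw : swapAt j w = w := by funext k; rw [swapAt_apply]; grind
      rw [← Module.End.mul_apply, ← hc.eq, Module.End.mul_apply]
      simp [tl, transp_apply, hsw]
    · exact absurd h1 (hw j)
  | @step u w φ hφ S' hS' hmem ih =>
    rw [add_sub_cancel_right] at ih
    have ih' := @ih (by linarith)
    have hpk' : ∀ i ∈ S', Peak (wordPeel w) i := fun i hi => peak_wordPeel ((hmem i).1 hi)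
    rw [LinearMap.comp_apply]
    obtain ⟨h0, ⟨h1, h2, h3⟩ | ⟨h1, k, hkS, hk, hk2⟩⟩ := straight_flip hpk hj
    · have hc : Commute (tl j) (layer (u - 1) S) := tl_commute_layer _ (by grind)
      rw [← Module.End.mul_apply (layer (u - 1) S), ← hc.eq, Module.End.mul_apply]
      exact ih' hS' hpk' (by rw [flip_wordPeel hmem, h3]) _
    · have hfar := far_of_peaks hS hpk
      have hfar' := far_of_peaks hS' hpk'
      have hjS' : j ∈ S' := (hmem j).2 h1
      have hc : Commute (tl j) (layer (u - 1) (S.erase k)) := by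
        refine tl_commute_layer _ fun i hi => ?_
        rw [hfar.mem_erase] at hi
        exact hk2 i hi.2 hi.1
      have hc' : Commute (yb (u - 1) k) (layer (u - 1) (S.erase k)) := by
        refine yb_commute_layer _ _ fun i hi => ?_
        rw [hfar.mem_erase] at hi
        have hi' := hpk i hi.2
        have hk' := hpk k hkS
        unfold Peak at hi' hk'
        grind
      -- Yang-Baxter with parameters `u`, `u - 1`, `-1`, as `tl` is `yb (-1)`. The assumption `1 <
      -- u` keeps `u` and `u - 1` nonzero.
      have hyb : yb u j * yb (u - 1) k * tl j = tl k * yb (u - 1) j * yb u k := by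
        have := yang_baxter (a := u) (b := -1) (i := j) (j := k) (by linarith) (by norm_num)
          (by intro h; linarith) (by omega)
        rw [tl_eq_yb, tl_eq_yb, sub_eq_add_neg]
        exact this
      have e : layer u S' * (layer (u - 1) S * tl j) =
          layer u (S'.erase j) * tl k * (yb (u - 1) j * yb u k * layer (u - 1) (S.erase k)) := by
        rw [layer_eq_erase_mul _ hfar hkS, layer_eq_erase_mul _ hfar' hjS', ← hc'.eq]
        calc layer u (S'.erase j) * yb u j * (yb (u - 1) k * layer (u - 1) (S.erase k) * tl j)
            = layer u (S'.erase j) * (yb u j * yb (u - 1) k * tl j) * layer (u - 1) (S.erase k) := by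
              simp only [mul_assoc, hc.eq]
          _ = _ := by rw [hyb]; simp only [mul_assoc]
      have e' := congrArg (fun x : Module.End ℚ WordFun => φ (x f)) e
      simp only [Module.End.mul_apply] at e' ⊢
      rw [e']
      -- The factor `tl k` now stands behind a layer lacking `j`; this is why the statement allows
      -- any set `S` of peaks.
      exact ih' (hfar'.erase j).nodup (fun i hi => hpk' i (List.mem_of_mem_erase hi))
        (flip_erase_straight hS' hmem h1 hk (hpk k hkS)) _

/-- Invariance under the transpositions at the straight positions of the word. -/
theorem IsFusion.tl_eq_zero {t : ℚ} {w : Word} {φ : WordFun →ₗ[ℚ] ℚ}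
    (h : IsFusion t w φ) (ht : 0 < t) {j : ℤ} (hj : w j = w (j + 1)) (f : WordFun) :
    φ (tl j f) = 0 := by
  cases h with
  | base hw =>
    have hsw : swapAt j w = w := by funext k; rw [swapAt_apply]; grind
    simp [tl, transp_apply, hsw]
  | @step _ _ φ hφ S hS hmem =>
    have := hφ.layer_tl_eq_zero (by linarith) hS (fun i hi => peak_wordPeel ((hmem i).1 hi))
      (j := j) (by rw [flip_wordPeel hmem, hj]) f
    rwa [add_sub_cancel_right] at this

/-- For `t = 1`, invariance under all transpositions but those at the peaks. -/
theorem IsFusion.tl_eq_zero_of_not_peak {w : Word} {φ : WordFun →ₗ[ℚ] ℚ}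
    (h : IsFusion 1 w φ) {j : ℤ} (hj : ¬ Peak w j) (f : WordFun) : φ (tl j f) = 0 := by
  by_cases hs : w j = w (j + 1)
  · exact h.tl_eq_zero one_pos hs f
  have hv : Valley w j := by unfold Peak at hj; unfold Valley; grind
  cases h with
  | base hw => exact absurd hv (hw j)
  | @step _ _ φ hφ S hS hmem =>
    rw [LinearMap.comp_apply, ← Module.End.mul_apply,
      layer_eq_erase_mul 1 (far_of_valleys hS fun i hi => (hmem i).1 hi) ((hmem j).2 hv),
      mul_assoc, yb_one_mul_tl]
    simp

/-! ### Contraction of a cup -/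

/-- The position of the letter `i` after deletion of the letters `p` and `p + 1`. -/
def shift (p i : ℤ) : ℤ := if i < p then i else i - 2

theorem yb_cup {p i : ℤ} (h : i + 2 ≤ p ∨ p + 2 ≤ i) (t : ℚ) (f : WordFun) :
    yb t i (cup p f) = cup p (yb t (shift p i) f) := by
  unfold yb shift
  simp only [LinearMap.add_apply, LinearMap.smul_apply, Module.End.one_apply, map_add, map_smul]
  congr 1
  split_ifs
  · exact transp_cup_of_lt (by omega) f
  · exact transp_cup_of_gt (by omega) f

theorem layer_cup {p : ℤ} {S : List ℤ} (h : ∀ i ∈ S, i + 2 ≤ p ∨ p + 2 ≤ i) (t : ℚ)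
    (f : WordFun) : layer t S (cup p f) = cup p (layer t (S.map (shift p)) f) := by
  induction S with
  | nil => simp [layer_nil]
  | cons i S ih =>
    rw [List.map_cons, layer_cons, layer_cons, Module.End.mul_apply, Module.End.mul_apply,
      ih fun j hj => h j (List.mem_cons_of_mem _ hj), yb_cup (h i List.mem_cons_self)]

theorem mem_map_shift {p : ℤ} {S : List ℤ} (h : ∀ i ∈ S, i + 2 ≤ p ∨ p + 2 ≤ i) (k : ℤ) :
    k ∈ S.map (shift p) ↔ (k + 2 ≤ p ∧ k ∈ S) ∨ (p ≤ k ∧ k + 2 ∈ S) := by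
  rw [List.mem_map]
  constructor
  · rintro ⟨i, hi, rfl⟩
    unfold shift
    split_ifs with hip
    · exact Or.inl ⟨by have := h i hi; omega, hi⟩
    · exact Or.inr ⟨by have := h i hi; omega, by simpa using hi⟩
  · rintro (⟨h1, h2⟩ | ⟨h1, h2⟩)
    · exact ⟨k, h2, by unfold shift; rw [if_pos (by omega)]⟩
    · exact ⟨k + 2, h2, by unfold shift; rw [if_neg (by omega)]; omega⟩

theorem nodup_map_shift {p : ℤ} {S : List ℤ} (hS : S.Nodup)
    (h : ∀ i ∈ S, i + 2 ≤ p ∨ p + 2 ≤ i) : (S.map (shift p)).Nodup := by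
  refine List.Nodup.map_on (fun i hi j hj hij => ?_) hS
  have h1 := h i hi
  have h2 := h j hj
  unfold shift at hij
  split_ifs at hij <;> omega

/-- Antisymmetry makes a cup an eigenvector of `tl p` for `-2`, so every functional that kills the
image of `tl p` kills cups at `p`. -/
theorem cup_eq_tl (p : ℤ) (f : WordFun) : cup p f = tl p ((-1 / 2 : ℚ) • cup p f) := by
  rw [map_smul, tl_cup_self, smul_smul]; norm_num

theorem yb_cup_self (t : ℚ) (p : ℤ) (f : WordFun) :
    yb t p (cup p f) = (1 / t - 1) • cup p f := by
  rw [yb_eq_tl, LinearMap.add_apply, tl_cup_self, LinearMap.smul_apply, Module.End.one_apply]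
  module

theorem yb_cup_left (t : ℚ) (p : ℤ) (f : WordFun) :
    yb t (p - 1) (cup p f) = cup (p - 1) f + (1 + 1 / t) • cup p f := by
  rw [yb_eq_tl, LinearMap.add_apply, tl_cup_left, LinearMap.smul_apply, Module.End.one_apply]

theorem yb_cup_right (t : ℚ) (p : ℤ) (f : WordFun) :
    yb t (p + 1) (cup p f) = cup (p + 1) f + (1 + 1 / t) • cup p f := by
  rw [yb_eq_tl, LinearMap.add_apply, tl_cup_right, LinearMap.smul_apply, Module.End.one_apply]

/-- Contraction at a peak all of whose neighbours are straight. -/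
theorem IsFusion.cup_step_straight {t : ℚ} {w : Word} {φ φ' : WordFun →ₗ[ℚ] ℚ} {S : List ℤ}
    (hS : S.Nodup) (hmem : ∀ i, i ∈ S ↔ Valley w i) {p : ℤ} (hp : Peak w p)
    (h1 : p - 1 ∉ S) (h2 : p + 1 ∉ S)
    (hφ' : IsFusion (t + 1) (del p (wordPeel w)) φ') (he : ∀ f, φ (cup p f) = φ' f) :
    ∃ ψ, IsFusion t (del p w) ψ ∧ ∀ f, φ (layer t S (cup p f)) = ψ f := by
  have hfar : ∀ i ∈ S, i + 2 ≤ p ∨ p + 2 ≤ i := by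
    intro i hi
    have := (hmem i).1 hi
    unfold Valley at this; unfold Peak at hp
    grind
  rw [hmem] at h1 h2
  unfold Peak at hp
  simp only [Valley, sub_add_cancel] at h1 h2
  have hpeel : del p (wordPeel w) = wordPeel (del p w) := by
    funext k; simp only [del, wordPeel]; grind
  rw [hpeel] at hφ'
  refine ⟨_, hφ'.step (nodup_map_shift hS hfar) fun i => ?_, fun f => ?_⟩
  · rw [mem_map_shift hfar, hmem, hmem]; simp only [Valley, del]; grind
  · rw [layer_cup hfar, he]; rfl

/-- Contraction at a peak with a valley on exactly one side. -/
theorem IsFusion.cup_step_side {t : ℚ} (ht : 0 < t) {w : Word} {φ φ' : WordFun →ₗ[ℚ] ℚ}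
    {S : List ℤ} (hφ : IsFusion (t + 1) (wordPeel w) φ)
    (hS : S.Nodup) (hmem : ∀ i, i ∈ S ↔ Valley w i) {p q : ℤ} (hp : Peak w p)
    (hq : q = p - 1 ∧ p + 1 ∉ S ∨ q = p + 1 ∧ p - 1 ∉ S) (hqS : q ∈ S)
    (hφ' : IsFusion (t + 1) (del q (wordPeel w)) φ') (he : ∀ f, φ (cup q f) = φ' f) :
    ∃ ψ, IsFusion t (del p w) ψ ∧ ∀ f, φ (layer t S (cup p f)) = ψ f := by
  have hfarS := far_of_valleys hS fun i hi => (hmem i).1 hi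
  have hfar : ∀ i ∈ S.erase q, (i + 2 ≤ q ∨ q + 2 ≤ i) ∧ (i + 2 ≤ p ∨ p + 2 ≤ i) := by
    intro i hi
    rw [hfarS.mem_erase] at hi
    have h3 := (hmem i).1 hi.2
    have h4 := (hmem q).1 hqS
    unfold Valley at h3 h4; unfold Peak at hp
    grind
  have hyb : ∀ f, yb t q (cup p f) = cup q f + (1 + 1 / t) • cup p f := by
    intro f
    rcases hq with ⟨rfl, -⟩ | ⟨rfl, -⟩
    · exact yb_cup_left t p f
    · exact yb_cup_right t p f
  have h4 := (hmem q).1 hqS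
  simp only [hmem] at hq
  unfold Peak at hp
  simp only [Valley, sub_add_cancel] at hq h4
  have hpeel : del q (wordPeel w) = wordPeel (del p w) := by
    funext k; simp only [del, wordPeel]; rcases hq with ⟨rfl, hq⟩ | ⟨rfl, hq⟩ <;> grind
  have hstr : wordPeel w p = wordPeel w (p + 1) := by
    simp only [wordPeel]; rcases hq with ⟨rfl, hq⟩ | ⟨rfl, hq⟩ <;> grind
  rw [hpeel] at hφ'
  refine ⟨_, hφ'.step (nodup_map_shift (hfarS.erase q).nodup fun i hi => (hfar i hi).1)
    fun i => ?_, fun f => ?_⟩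
  · rw [mem_map_shift fun i hi => (hfar i hi).1, hfarS.mem_erase, hfarS.mem_erase, hmem, hmem]
    simp only [Valley, del]; rcases hq with ⟨rfl, hq⟩ | ⟨rfl, hq⟩ <;> grind
  · have hc : Commute (tl p) (layer t (S.erase q)) :=
      tl_commute_layer t fun i hi => (hfar i hi).2
    -- Of the two terms of `hyb`, the cup at `p` dies because the peeled word has equal letters at
    -- `p, p + 1`; the cup at `q` is contracted at the peak of the peeled word.
    rw [layer_eq_erase_mul t hfarS hqS, Module.End.mul_apply, hyb, map_add, map_add, map_smul,
      map_smul, cup_eq_tl p, ← Module.End.mul_apply _ (tl p), ← hc.eq,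
      Module.End.mul_apply, hφ.tl_eq_zero (by linarith) hstr,
      layer_cup fun i hi => (hfar i hi).1, he]
    simp

/-- Contraction at a peak between two valleys. -/
theorem IsFusion.cup_step_both {t : ℚ} (ht : 0 < t) {w : Word}
    {φ φ₀ φ₁ φ₂ : WordFun →ₗ[ℚ] ℚ}
    {S : List ℤ} (hS : S.Nodup) (hmem : ∀ i, i ∈ S ↔ Valley w i) {p : ℤ} (hp : Peak w p)
    (h1 : p - 1 ∈ S) (h2 : p + 1 ∈ S)
    (hφ₀ : IsFusion (t + 1) (del p (wordPeel w)) φ₀)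
    (he₀ : ∀ f, φ (cup p f) = (1 / (t + 1) - 1) * φ₀ f)
    (hφ₁ : IsFusion (t + 1) (del (p - 1) (wordPeel w)) φ₁) (he₁ : ∀ f, φ (cup (p - 1) f) = φ₁ f)
    (hφ₂ : IsFusion (t + 1) (del (p + 1) (wordPeel w)) φ₂) (he₂ : ∀ f, φ (cup (p + 1) f) = φ₂ f) :
    ∃ ψ, IsFusion t (del p w) ψ ∧ ∀ f, φ (layer t S (cup p f)) = ψ f := by
  have hfarS := far_of_valleys hS fun i hi => (hmem i).1 hi
  set S₀ := (S.erase (p - 1)).erase (p + 1) with hS₀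
  have hfarS₀ : Far S₀ := (hfarS.erase _).erase _
  have hmem₀ : ∀ i, i ∈ S₀ ↔ i ≠ p + 1 ∧ i ≠ p - 1 ∧ i ∈ S := fun i => by
    rw [hS₀, (hfarS.erase _).mem_erase, hfarS.mem_erase]
  have hfar : ∀ i ∈ S₀, i + 3 ≤ p ∨ p + 3 ≤ i := by
    intro i hi
    rw [hmem₀] at hi
    have h3 := (hmem i).1 hi.2.2
    have h4 := (hmem (p - 1)).1 h1
    have h5 := (hmem (p + 1)).1 h2
    unfold Valley at h3 h4 h5; unfold Peak at hp
    grind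
  have hlayer : layer t S = layer t S₀ * yb t (p + 1) * yb t (p - 1) := by
    rw [layer_eq_erase_mul t hfarS h1, layer_eq_erase_mul t (hfarS.erase _)
      (hfarS.mem_erase.2 ⟨by omega, h2⟩)]
  have h4 := (hmem (p - 1)).1 h1
  have h5 := (hmem (p + 1)).1 h2
  unfold Peak at hp
  simp only [Valley, sub_add_cancel] at h4 h5
  have hp0 : del p (wordPeel w) = wordPeel (del p w) := by
    funext k; simp only [del, wordPeel]; grind
  have hp1 : del (p - 1) (wordPeel w) = wordPeel (del p w) := by
    funext k; simp only [del, wordPeel]; grind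
  have hp2 : del (p + 1) (wordPeel w) = wordPeel (del p w) := by
    funext k; simp only [del, wordPeel]; grind
  rw [hp0] at hφ₀
  rw [hp1] at hφ₁
  rw [hp2] at hφ₂
  -- The peeled word reads `1010` around `p`, so deleting at `p - 1`, `p` or `p + 1` leaves the same
  -- word and hence the same functional.
  obtain rfl := hφ₀.unique hφ₁
  obtain rfl := hφ₀.unique hφ₂
  have hm1 : S₀.map (shift (p - 1)) = S₀.map (shift p) :=
    List.map_congr_left fun i hi => by have := hfar i hi; unfold shift; grind
  have hm2 : S₀.map (shift (p + 1)) = S₀.map (shift p) :=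
    List.map_congr_left fun i hi => by have := hfar i hi; unfold shift; grind
  have hf0 : ∀ i ∈ S₀, i + 2 ≤ p ∨ p + 2 ≤ i := fun i hi => by have := hfar i hi; omega
  have hf1 : ∀ i ∈ S₀, i + 2 ≤ p - 1 ∨ p - 1 + 2 ≤ i := fun i hi => by
    have := hfar i hi; omega
  have hf2 : ∀ i ∈ S₀, i + 2 ≤ p + 1 ∨ p + 1 + 2 ≤ i := fun i hi => by
    have := hfar i hi; omega
  refine ⟨_, hφ₀.step (S := S₀.map (shift p) ++ [p - 1]) ?_ fun i => ?_, fun f => ?_⟩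
  · refine (nodup_map_shift hfarS₀.nodup hf0).append (List.nodup_singleton _) ?_
    rw [List.disjoint_singleton, mem_map_shift hf0]
    intro h
    have := hfar (p - 1)
    have := hfar (p - 1 + 2)
    grind
  · rw [List.mem_append, List.mem_singleton, mem_map_shift hf0, hmem₀, hmem₀, hmem, hmem]
    simp only [Valley, del]; grind
  · have e : yb t (p + 1) (yb t (p - 1) (cup p f)) = cup (p + 1) (yb t (p - 1) f) +
        (1 + 1 / t) • cup (p - 1) f + ((1 + 1 / t) * (1 + 1 / t)) • cup p f := by
      have hcm : yb t (p + 1) (yb t (p - 1) (cup p f)) = yb t (p - 1) (yb t (p + 1) (cup p f)) :=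
        congrArg (fun x : Module.End ℚ WordFun => x (cup p f))
          (yb_commute t t (i := p + 1) (j := p - 1) (by omega)).eq
      rw [hcm, yb_cup_right, map_add, map_smul, yb_cup_left, yb_cup (by omega),
        show shift (p + 1) (p - 1) = p - 1 by unfold shift; rw [if_pos (by omega)]]
      module
    rw [hlayer, Module.End.mul_apply, Module.End.mul_apply, e]
    simp only [map_add, map_smul, layer_cup hf0, layer_cup hf1, layer_cup hf2, hm1, hm2, he₀, he₁,
      he₂]
    rw [LinearMap.comp_apply, layer_append, layer_cons, layer_nil, mul_one, Module.End.mul_apply]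
    simp only [smul_eq_mul]
    -- The cup at `p`, weighted by the scalar of the enclosed valley, cancels the cup at `p - 1`.
    -- The cup at `p + 1` survives with the operator at `p - 1`, the valley of the contracted word.
    have : (1 + 1 / t) * (1 + 1 / t) * (1 / (t + 1) - 1) = - (1 + 1 / t) := by
      have : t + 1 ≠ 0 := by linarith
      field_simp; ring
    linear_combination this * φ₀ (layer t (S₀.map (shift p)) f)

/-- Contraction at a valley enclosed by two peaks. -/
theorem IsFusion.cup_step_valley {t : ℚ} {w : Word} {φ φ' : WordFun →ₗ[ℚ] ℚ} {S : List ℤ}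
    (hS : S.Nodup) (hmem : ∀ i, i ∈ S ↔ Valley w i) {p : ℤ} (hp : Valley w p)
    (h1 : w (p - 1) = true) (h2 : w (p + 2) = false)
    (hφ' : IsFusion (t + 1) (del p (wordPeel w)) φ') (he : ∀ f, φ (cup p f) = φ' f) :
    ∃ ψ, IsFusion t (del p w) ψ ∧ ∀ f, φ (layer t S (cup p f)) = (1 / t - 1) * ψ f := by
  have hfarS := far_of_valleys hS fun i hi => (hmem i).1 hi
  have hpS := (hmem p).2 hp
  have hfar : ∀ i ∈ S.erase p, i + 2 ≤ p ∨ p + 2 ≤ i := by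
    intro i hi
    rw [hfarS.mem_erase, hmem] at hi
    unfold Valley at hp hi
    grind
  unfold Valley at hp
  have hpeel : del p (wordPeel w) = wordPeel (del p w) := by
    funext k; simp only [del, wordPeel]; grind
  rw [hpeel] at hφ'
  refine ⟨_, hφ'.step (nodup_map_shift (hfarS.erase p).nodup hfar) fun i => ?_, fun f => ?_⟩
  · rw [mem_map_shift hfar, hfarS.mem_erase, hfarS.mem_erase, hmem, hmem]
    simp only [Valley, del]; grind
  · rw [layer_eq_erase_mul t hfarS hpS, Module.End.mul_apply, yb_cup_self, map_smul, map_smul,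
      layer_cup hfar, he]
    rfl

/-- Contraction at a peak, and at a valley enclosed by two peaks. -/
theorem IsFusion.cup {t : ℚ} {w : Word} {φ : WordFun →ₗ[ℚ] ℚ} (h : IsFusion t w φ) (ht : 0 < t) :
    (∀ p, Peak w p → ∃ ψ, IsFusion t (del p w) ψ ∧ ∀ f, φ (cup p f) = ψ f) ∧
    ∀ p, Valley w p → w (p - 1) = true → w (p + 2) = false →
      ∃ ψ, IsFusion t (del p w) ψ ∧ ∀ f, φ (HankelKL.cup p f) = (1 / t - 1) * ψ f := by
  induction h with
  | @base t w hw =>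
    refine ⟨fun p hp => ⟨_, .base fun i => ?_, fun f => ?_⟩, fun p hp => absurd hp (hw p)⟩
    · have a1 := hw i
      have a2 := hw (i + 2)
      have a3 := hw p
      have a4 := hw (p - 1)
      have a5 := hw (p + 1)
      unfold Peak at hp
      unfold Valley at *
      simp only [del]; grind
    · simp [cup_apply, hp.1, hp.2, bit]
  | @step t w φ hφ S hS hmem ih =>
    obtain ⟨ihp, ihv⟩ := ih (by linarith)
    refine ⟨fun p hp => ?_, fun p hp h1 h2 => ?_⟩
    · have hpeak : ∀ i ∈ S, Peak (wordPeel w) i := fun i hi => peak_wordPeel ((hmem i).1 hi)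
      by_cases h1 : p - 1 ∈ S <;> by_cases h2 : p + 1 ∈ S
      · obtain ⟨φ₁, hφ₁, he₁⟩ := ihp _ (hpeak _ h1)
        obtain ⟨φ₂, hφ₂, he₂⟩ := ihp _ (hpeak _ h2)
        have b1 := (hmem _).1 h1
        have b2 := (hmem _).1 h2
        obtain ⟨φ₀, hφ₀, he₀⟩ := ihv p
          (by unfold Peak at hp; unfold Valley at b1 b2; simp only [Valley, wordPeel]; grind)
          (hpeak _ h1).1 (by have := (hpeak _ h2).2; rwa [add_assoc] at this)
        exact IsFusion.cup_step_both ht hS hmem hp h1 h2 hφ₀ he₀ hφ₁ he₁ hφ₂ he₂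
      · obtain ⟨φ₁, hφ₁, he₁⟩ := ihp _ (hpeak _ h1)
        exact IsFusion.cup_step_side ht hφ hS hmem hp (Or.inl ⟨rfl, h2⟩) h1 hφ₁ he₁
      · obtain ⟨φ₂, hφ₂, he₂⟩ := ihp _ (hpeak _ h2)
        exact IsFusion.cup_step_side ht hφ hS hmem hp (Or.inr ⟨rfl, h1⟩) h2 hφ₂ he₂
      · obtain ⟨φ₀, hφ₀, he₀⟩ := ihp p (by
          have b1 := (hmem (p - 1)).not.1 h1
          have b2 := (hmem (p + 1)).not.1 h2
          unfold Peak at hp ⊢; unfold Valley at b1 b2; simp only [wordPeel]; grind)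
        exact IsFusion.cup_step_straight hS hmem hp h1 h2 hφ₀ he₀
    · obtain ⟨φ₀, hφ₀, he₀⟩ := ihp p (peak_wordPeel hp)
      exact IsFusion.cup_step_valley hS hmem hp h1 h2 hφ₀ he₀

/-! ### Link patterns and their duality with fused functionals -/

/-- `f` is the link-pattern product of the word `w`, which is obtained from the word constant
equal to `1` and then to `0` by `n` insertions of factors `10`. -/
inductive IsLink : ℕ → Word → WordFun → Prop
  | base : IsLink 0 (fun k => decide (k ≤ 0)) 1
  | step {n : ℕ} {w : Word} {f : WordFun} (h : IsLink n w f) {p : ℤ} (h1 : 1 ≤ p)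
      (h2 : p ≤ 2 * n + 1) : IsLink (n + 1) (ins p w) (cup p f)

theorem del_ins (p : ℤ) (w : Word) : del p (ins p w) = w := by
  funext k; simp only [del, ins]; grind

theorem ins_del {p : ℤ} {w : Word} (h : Peak w p) : ins p (del p w) = w := by
  unfold Peak at h
  funext k; simp only [del, ins]; grind

theorem peak_ins (p : ℤ) (w : Word) : Peak (ins p w) p := by
  simp only [Peak, ins]; grind

/-- The duality between link-pattern products and fused functionals. -/
theorem IsLink.duality {n : ℕ} {w : Word} {f : WordFun} (h : IsLink n w f) {v : Word}
    (hv : ∀ k ≤ 0, v k = true) (hv' : ∀ k > 2 * (n : ℤ), v k = false) {φ : WordFun →ₗ[ℚ] ℚ}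
    (hφ : IsFusion 1 v φ) : (w = v → φ f = 1) ∧ (w ≠ v → φ f = 0) := by
  induction h generalizing v φ with
  | base =>
    have e : v = fun k => decide (k ≤ 0) := by
      funext k
      have a1 := hv k
      have a2 := hv' k
      grind
    subst e
    rw [hφ.eq_proj fun i => by unfold Valley; grind]
    simp
  | @step n w f h p h1 h2 ih =>
    by_cases hp : Peak v p
    · obtain ⟨ψ, hψ, he⟩ := (hφ.cup one_pos).1 p hp
      obtain ⟨i1, i2⟩ := ih (v := del p v)
        (fun k hk => by simp only [del]; rw [if_pos (by omega)]; exact hv k hk)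
        (fun k hk => by
          simp only [del]; rw [if_neg (by omega)]
          exact hv' _ (by push_cast; omega)) hψ
      rw [he]
      refine ⟨fun hw => i1 ?_, fun hw => i2 fun hw' => hw ?_⟩
      · rw [← hw, del_ins]
      · rw [hw', ins_del hp]
    · rw [cup_eq_tl, hφ.tl_eq_zero_of_not_peak hp]
      exact ⟨fun e => absurd (e ▸ peak_ins p w) hp, fun _ => rfl⟩

theorem IsLink.bounds {n : ℕ} {w : Word} {f : WordFun} (h : IsLink n w f) :
    (∀ k ≤ 0, w k = true) ∧ ∀ k > 2 * (n : ℤ), w k = false := by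
  induction h with
  | base => simp
  | @step n w f h p h1 h2 ih =>
    refine ⟨fun k hk => ?_, fun k hk => ?_⟩
    · simp only [ins]; rw [if_pos (by omega)]; exact ih.1 k hk
    · push_cast at hk
      simp only [ins]
      rw [if_neg (by omega), if_neg (by omega)]
      split_ifs
      · rfl
      · exact ih.2 _ (by omega)

/-- Replacing a factor `01` by `10` amounts to the action of `s_i - 1`. -/
theorem IsLink.tl {n : ℕ} {w : Word} {f : WordFun} (h : IsLink n w f) {i : ℤ}
    (hi : Valley w i) : IsLink n (swapAt i w) (tl i f) := by
  induction h generalizing i with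
  | base => unfold Valley at hi; grind
  | @step n w f h p h1 h2 ih =>
    obtain ⟨b1, b2⟩ := h.bounds
    simp only [Valley, ins] at hi
    have htl : ∀ j g, HankelKL.tl j g = transp j g - g := fun _ _ => rfl
    rcases lt_trichotomy i p with hip | rfl | hip
    · rcases eq_or_lt_of_le (Int.le_sub_one_of_lt hip) with rfl | hip'
      · have e : swapAt (p - 1) (ins p w) = ins (p - 1) w := by
          funext k; simp only [swapAt_apply, ins]; grind
        rw [tl_cup_left, e]
        -- The new cup stays at a position at least 1: the letter at `p - 1` is 0, whereas all
        -- letters at positions at most 0 are 1.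
        exact .step h (by by_contra hp; have := b1 (p - 1); grind) (by omega)
      · have e : swapAt i (ins p w) = ins p (swapAt i w) := by
          funext k; simp only [swapAt_apply, ins]; grind
        have := ih (i := i) (by unfold Valley; grind)
        rw [htl] at this
        rw [htl, transp_cup_of_lt (by omega), ← map_sub, e]
        exact .step this h1 h2
    · grind
    · rcases eq_or_lt_of_le (Int.add_one_le_of_lt hip) with rfl | hip'
      · have e : swapAt (p + 1) (ins p w) = ins (p + 1) w := by
          funext k; simp only [swapAt_apply, ins]; grind
        rw [tl_cup_right, e]
        exact .step h (by omega) (by by_contra hp; have := b2 p; grind)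
      · have e : swapAt i (ins p w) = ins p (swapAt (i - 2) w) := by
          funext k; simp only [swapAt_apply, ins]; grind
        have := ih (i := i - 2) (by unfold Valley; grind)
        rw [htl] at this
        rw [htl, transp_cup_of_gt (by omega), ← map_sub, e]
        exact .step this h1 h2

/-! ### Dictionary between diagrams and words -/

open YoungDiagram (mem_iff_lt_rowLen)

/-- The Yamanouchi word of a diagram, continued by `1` to the left and by `0` to the right. -/
def word (n : ℕ) (lam : YoungDiagram) : Word := fun k =>
  decide (k ≤ 0 ∨ ∃ r ∈ Finset.range n, k = n - r + lam.rowLen r)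

theorem word_eq_true {n : ℕ} {lam : YoungDiagram} {k : ℤ} :
    word n lam k = true ↔ k ≤ 0 ∨ ∃ r < n, k = n - r + lam.rowLen r := by
  simp [word]

theorem word_eq_false {n : ℕ} {lam : YoungDiagram} {k : ℤ} :
    word n lam k = false ↔ 0 < k ∧ ∀ r < n, k ≠ n - r + lam.rowLen r := by
  simp [word]

theorem mem_staircase {n : ℕ} {c : ℕ × ℕ} : c ∈ staircase n ↔ c.1 + c.2 + 1 < n := by
  rw [← YoungDiagram.mem_cells]
  simp only [staircase, Finset.mem_filter, Finset.mem_product, Finset.mem_range]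
  omega

theorem add_rowLen_lt {n : ℕ} {lam : YoungDiagram} (h : lam ≤ staircase n) {r : ℕ}
    (hr : 0 < lam.rowLen r) : r + lam.rowLen r < n := by
  have h1 : (r, lam.rowLen r - 1) ∈ lam := mem_iff_lt_rowLen.2 (by omega)
  have h2 := mem_staircase.1 (h h1)
  simp only at h2
  omega

theorem label_cast {n : ℕ} {lam : YoungDiagram} (h : lam ≤ staircase n) {c : ℕ × ℕ}
    (hc : c ∈ lam) : (label n c : ℤ) = n + c.2 - c.1 ∧ 1 ≤ label n c := by
  have := mem_staircase.1 (h hc)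
  unfold label
  omega

theorem isCorner_iff {lam : YoungDiagram} {c : ℕ × ℕ} :
    IsCorner lam c ↔ lam.rowLen c.1 = c.2 + 1 ∧ lam.rowLen (c.1 + 1) ≤ c.2 := by
  obtain ⟨a, b⟩ := c
  simp only [IsCorner, mem_iff_lt_rowLen]
  have := lam.rowLen_anti a (a + 1) (by omega)
  omega

theorem valley_word_iff {n : ℕ} {lam : YoungDiagram} (h : lam ≤ staircase n) {i : ℤ} :
    Valley (word n lam) i ↔ ∃ c, IsCorner lam c ∧ (label n c : ℤ) = i := by
  simp only [Valley, word_eq_true, word_eq_false]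
  constructor
  · rintro ⟨⟨h1, h2⟩, h3 | ⟨r, hr, h3⟩⟩
    · omega
    · have h4 := lam.rowLen_anti r (r + 1) (by omega)
      have h5 := h2 (r + 1)
      have h6 := @add_rowLen_lt n lam h r
      have hc : IsCorner lam (r, lam.rowLen r - 1) := by
        rw [isCorner_iff]; simp only; push_cast at h5; omega
      refine ⟨_, hc, ?_⟩
      rw [(label_cast h hc.1).1]
      have := isCorner_iff.1 hc
      simp only at this ⊢
      omega
  · rintro ⟨⟨r, j⟩, hc, rfl⟩
    rw [(label_cast h hc.1).1]
    have h6 := @add_rowLen_lt n lam h r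
    obtain ⟨h1, h2⟩ := isCorner_iff.1 hc
    simp only at h1 h2 ⊢
    refine ⟨⟨by omega, fun r' hr' => ?_⟩, Or.inr ⟨r, by omega, by omega⟩⟩
    rcases le_or_gt r' r with h3 | h3
    · have := lam.rowLen_anti r' r h3
      omega
    · have := lam.rowLen_anti (r + 1) r' h3
      omega

theorem mem_peel {lam : YoungDiagram} {c : ℕ × ℕ} :
    c ∈ peel lam ↔ c ∈ lam ∧ ((c.1 + 1, c.2) ∈ lam ∨ (c.1, c.2 + 1) ∈ lam) := by
  rw [← YoungDiagram.mem_cells]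
  simp [peel]

theorem mem_peel_iff {lam : YoungDiagram} {c : ℕ × ℕ} :
    c ∈ peel lam ↔ c ∈ lam ∧ ¬ IsCorner lam c := by
  rw [mem_peel]; unfold IsCorner; tauto

theorem peel_le (lam : YoungDiagram) : peel lam ≤ lam := fun _ hc => (mem_peel.1 hc).1

theorem eq_of_forall_lt_iff {a b : ℕ} (h : ∀ j, j < a ↔ j < b) : a = b := by
  have := h a
  have := h b
  omega

theorem rowLen_peel (lam : YoungDiagram) (r : ℕ) :
    (peel lam).rowLen r = max (lam.rowLen (r + 1)) (lam.rowLen r - 1) := by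
  refine eq_of_forall_lt_iff fun j => ?_
  have := lam.rowLen_anti r (r + 1) (by omega)
  rw [← mem_iff_lt_rowLen, mem_peel]
  simp only [mem_iff_lt_rowLen]
  omega

/-- Row `r` loses a box exactly when it is strictly longer than row `r + 1`, that is, when its
letter 1 is preceded by a 0; the letter then moves one place left. -/
theorem word_peel {n : ℕ} {lam : YoungDiagram} (h : lam ≤ staircase n) :
    word n (peel lam) = wordPeel (word n lam) := by
  funext k
  rw [Bool.eq_iff_iff, word_eq_true]
  simp only [rowLen_peel, wordPeel]
  -- The last of the `n` rows is empty, so its letter 1 is at position 1, right after the constant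
  -- part of the word.
  have hz : ∀ r, r + 1 = n → lam.rowLen r = 0 := fun r hr => by
    have := @add_rowLen_lt n lam h r; omega
  constructor
  · rintro (hk | ⟨r, hr, hk⟩)
    · have h1 : word n lam k = true := word_eq_true.2 (Or.inl hk)
      simp only [h1, if_true]
      exact word_eq_true.2 (Or.inl (by omega))
    · have h4 := lam.rowLen_anti r (r + 1) (by omega)
      have h5 := hz r
      rcases eq_or_lt_of_le h4 with h4 | h4
      · have h1 : word n lam k = true := word_eq_true.2 (Or.inr ⟨r, hr, by omega⟩)
        simp only [h1, if_true, word_eq_true]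
        rcases Nat.lt_or_ge (r + 1) n with h6 | h6
        · exact Or.inr ⟨r + 1, h6, by push_cast; omega⟩
        · exact Or.inl (by omega)
      · have hc : IsCorner lam (r, lam.rowLen r - 1) := by
          rw [isCorner_iff]; simp only; omega
        have hv := (valley_word_iff h (i := k)).2 ⟨_, hc, by
          rw [(label_cast h hc.1).1]; simp only; omega⟩
        simp [hv.1, hv.2]
  · split_ifs with h1
    · rw [word_eq_true] at h1
      rw [word_eq_true]
      rintro (h2 | ⟨s, hs, h2⟩)
      · rcases h1 with h1 | ⟨r, hr, h1⟩
        · exact Or.inl h1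
        · have := hz r
          have := lam.rowLen_anti r (r + 1) (by omega)
          exact Or.inr ⟨r, hr, by omega⟩
      · rcases h1 with h1 | ⟨r, hr, h1⟩
        · exact Or.inl h1
        · rcases le_or_gt s r with h3 | h3
          · have := lam.rowLen_anti s r h3
            omega
          · have h5 := lam.rowLen_anti (r + 1) s h3
            have h6 := lam.rowLen_anti r (r + 1) (by omega)
            exact Or.inr ⟨r, hr, by omega⟩
    · intro h2
      have hv : Valley (word n lam) k := ⟨by simpa using h1, h2⟩
      obtain ⟨c, hc, hk⟩ := (valley_word_iff h).1 hv
      rw [(label_cast h hc.1).1] at hk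
      have h3 := isCorner_iff.1 hc
      have h4 := mem_staircase.1 (h hc.1)
      exact Or.inr ⟨c.1, by omega, by omega⟩

theorem word_bot (n : ℕ) : word n ⊥ = fun k => decide (k ≤ (n : ℤ)) := by
  have h0 : ∀ r, (⊥ : YoungDiagram).rowLen r = 0 := fun r => by
    by_contra h
    exact YoungDiagram.notMem_bot _
      (mem_iff_lt_rowLen.2 (Nat.pos_of_ne_zero h) : (r, 0) ∈ (⊥ : YoungDiagram))
  funext k
  rw [Bool.eq_iff_iff, word_eq_true]
  simp only [h0, decide_eq_true_eq]
  constructor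
  · rintro (h | ⟨r, hr, h⟩) <;> omega
  · intro h
    by_cases hk : k ≤ 0
    · exact Or.inl hk
    · exact Or.inr ⟨(n - k).toNat, by omega, by omega⟩

theorem word_bounds {n : ℕ} {lam : YoungDiagram} (h : lam ≤ staircase n) :
    (∀ k ≤ 0, word n lam k = true) ∧ ∀ k > 2 * (n : ℤ), word n lam k = false := by
  refine ⟨fun k hk => word_eq_true.2 (Or.inl hk), fun k hk => word_eq_false.2 ⟨by omega, ?_⟩⟩
  intro r hr
  have := @add_rowLen_lt n lam h r
  omega

/-- The positions `n - r + lam.rowLen r` decrease strictly with `r`, so the rows are recovered in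
order from the rightmost letter 1. -/
theorem word_injective {n : ℕ} {lam mu : YoungDiagram} (hlam : lam ≤ staircase n)
    (hmu : mu ≤ staircase n) (h : word n lam = word n mu) : lam = mu := by
  have key : ∀ {lam mu : YoungDiagram}, word n lam = word n mu → ∀ r < n,
      (∀ s < r, lam.rowLen s = mu.rowLen s) → lam.rowLen r ≤ mu.rowLen r := by
    intro lam mu h r hr ih
    have h1 : word n lam (n - r + lam.rowLen r) = true := word_eq_true.2 (Or.inr ⟨r, hr, rfl⟩)
    rw [h, word_eq_true] at h1
    obtain h1 | ⟨s, hs, h1⟩ := h1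
    · omega
    · rcases Nat.lt_or_ge s r with h2 | h2
      · have := ih s h2
        have := lam.rowLen_anti s r h2.le
        omega
      · have := mu.rowLen_anti r s h2
        omega
  have hrow : ∀ r, lam.rowLen r = mu.rowLen r := by
    intro r
    induction r using Nat.strong_induction_on with
    | _ r ih =>
      rcases Nat.lt_or_ge r n with hr | hr
      · exact le_antisymm (key h r hr ih) (key h.symm r hr fun s hs => (ih s hs).symm)
      · have := @add_rowLen_lt n lam hlam r
        have := @add_rowLen_lt n mu hmu r
        omega
  refine YoungDiagram.ext (Finset.ext fun c => ?_)
  obtain ⟨a, b⟩ := c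
  rw [YoungDiagram.mem_cells, YoungDiagram.mem_cells, mem_iff_lt_rowLen, mem_iff_lt_rowLen, hrow]

theorem mem_of_insert {lam mu : YoungDiagram} {c : ℕ × ℕ} (h : lam.cells = insert c mu.cells)
    {d : ℕ × ℕ} : d ∈ lam ↔ d = c ∨ d ∈ mu := by
  rw [← YoungDiagram.mem_cells, h, Finset.mem_insert, YoungDiagram.mem_cells]

theorem rowLen_insert {lam mu : YoungDiagram} {c : ℕ × ℕ} (hc : c ∉ mu)
    (h : lam.cells = insert c mu.cells) :
    mu.rowLen c.1 = c.2 ∧ lam.rowLen c.1 = c.2 + 1 ∧ ∀ r ≠ c.1, lam.rowLen r = mu.rowLen r := by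
  obtain ⟨a, b⟩ := c
  have key : ∀ r j, j < lam.rowLen r ↔ (r = a ∧ j = b) ∨ j < mu.rowLen r := fun r j => by
    rw [← mem_iff_lt_rowLen, ← mem_iff_lt_rowLen, mem_of_insert h, Prod.mk.injEq]
  rw [mem_iff_lt_rowLen] at hc
  have k1 := key a b
  have k2 := key a (b + 1)
  have k3 := key a (mu.rowLen a)
  refine ⟨by simp only; omega, by simp only; omega, fun r hr => eq_of_forall_lt_iff fun j => ?_⟩
  rw [key]
  simp only at hr
  omega

theorem isCorner_of_insert {lam mu : YoungDiagram} {c : ℕ × ℕ} (hc : c ∉ mu)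
    (h : lam.cells = insert c mu.cells) : IsCorner lam c := by
  obtain ⟨h1, h2, h3⟩ := rowLen_insert hc h
  rw [isCorner_iff, h3 (c.1 + 1) (by omega)]
  have := mu.rowLen_anti c.1 (c.1 + 1) (by omega)
  omega

theorem le_of_insert {lam mu : YoungDiagram} {c : ℕ × ℕ} (h : lam.cells = insert c mu.cells) :
    mu ≤ lam := fun _ hd => (mem_of_insert h).2 (Or.inr hd)

theorem word_insert {n : ℕ} {lam mu : YoungDiagram} (hlam : lam ≤ staircase n) {c : ℕ × ℕ}
    (hc : c ∉ mu) (h : lam.cells = insert c mu.cells) :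
    word n mu = swapAt (label n c) (word n lam) := by
  have hco := isCorner_of_insert hc h
  obtain ⟨v1, v2⟩ := (valley_word_iff hlam).2 ⟨c, hco, rfl⟩
  have hlab := (label_cast hlam hco.1).1
  have hst := mem_staircase.1 (hlam hco.1)
  obtain ⟨h1, h2, h3⟩ := rowLen_insert hc h
  funext k
  rw [swapAt_apply]
  split_ifs with hk hk'
  · rw [v2, word_eq_true]
    exact Or.inr ⟨c.1, by omega, by omega⟩
  · rw [v1, word_eq_false]
    refine ⟨by omega, fun r hr => ?_⟩
    rcases lt_trichotomy r c.1 with hrc | rfl | hrc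
    · have := lam.rowLen_anti r c.1 hrc.le
      have := h3 r (by omega)
      omega
    · omega
    · have := mu.rowLen_anti c.1 r hrc.le
      omega
  · rw [Bool.eq_iff_iff, word_eq_true, word_eq_true]
    refine or_congr_right (exists_congr fun r => and_congr_right fun hr => ?_)
    by_cases hrc : r = c.1
    · subst hrc; omega
    · rw [h3 r hrc]

/-! ### Levels, and the row reading as a product of layers -/

theorem level_eq_zero {lam : YoungDiagram} {c : ℕ × ℕ} (h : IsCorner lam c) : level lam c = 0 :=
  Nat.sInf_eq_zero.2 (Or.inl h)

theorem peel_bound {M : ℕ} {lam : YoungDiagram} (h : ∀ c ∈ lam, c.1 + c.2 < M + 1) :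
    ∀ c ∈ peel lam, c.1 + c.2 < M := by
  intro c hc
  obtain ⟨-, hc | hc⟩ := mem_peel.1 hc
  all_goals have := h _ hc; simp only at this; omega

theorem exists_isCorner {M : ℕ} {lam : YoungDiagram} (h : ∀ c ∈ lam, c.1 + c.2 < M)
    {c : ℕ × ℕ} (hc : c ∈ lam) : ∃ k, IsCorner (peel^[k] lam) c := by
  induction M generalizing lam with
  | zero => exact absurd (h c hc) (Nat.not_lt_zero _)
  | succ M ih =>
    by_cases hco : IsCorner lam c
    · exact ⟨0, hco⟩
    · obtain ⟨k, hk⟩ := ih (peel_bound h) (mem_peel_iff.2 ⟨hc, hco⟩)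
      exact ⟨k + 1, by rwa [Function.iterate_succ_apply]⟩

/-- The bound `M` serves to show that the sets defining the levels are nonempty, as `sInf ∅ = 0`
would be meaningless here. -/
theorem level_eq_succ {M : ℕ} {lam : YoungDiagram} (h : ∀ c ∈ lam, c.1 + c.2 < M)
    {c : ℕ × ℕ} (hc : c ∈ peel lam) : level lam c = level (peel lam) c + 1 := by
  have h0 : ¬ IsCorner lam c := (mem_peel_iff.1 hc).2
  have h1 : {k | IsCorner (peel^[k] lam) c}.Nonempty := exists_isCorner h (peel_le _ hc)
  have h2 : {k | IsCorner (peel^[k] (peel lam)) c}.Nonempty :=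
    exists_isCorner (fun d hd => h d (peel_le _ hd)) hc
  unfold level
  apply le_antisymm
  · refine Nat.sInf_le ?_
    have := Nat.sInf_mem h2
    simpa only [Set.mem_ofPred_eq, Function.iterate_succ_apply] using this
  · have h3 := Nat.sInf_mem h1
    rcases hk : sInf {k | IsCorner (peel^[k] lam) c} with _ | k
    · rw [hk] at h3; exact absurd h3 h0
    · rw [hk] at h3
      exact Nat.succ_le_succ (Nat.sInf_le (by
        simpa only [Set.mem_ofPred_eq, Function.iterate_succ_apply] using h3))

theorem level_lt {M : ℕ} {lam : YoungDiagram} (h : ∀ c ∈ lam, c.1 + c.2 < M) {x y : ℕ × ℕ}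
    (hy : y ∈ lam) (hxy : x ≤ y) (hne : x ≠ y) : level lam y < level lam x := by
  induction M generalizing lam with
  | zero => exact absurd (h y hy) (Nat.not_lt_zero _)
  | succ M ih =>
    have hx : x ∈ peel lam := by
      obtain ⟨h1, h2⟩ := Prod.le_def.1 hxy
      obtain ⟨a, b⟩ := x
      obtain ⟨c, d⟩ := y
      simp only [ne_eq, Prod.mk.injEq] at h1 h2 hne
      refine mem_peel.2 ⟨lam.up_left_mem h1 h2 hy, ?_⟩
      rcases Nat.lt_or_ge a c with h3 | h3
      · exact Or.inl (lam.up_left_mem h3 h2 hy)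
      · exact Or.inr (lam.up_left_mem h1 (by simp only; omega) hy)
    rw [level_eq_succ h hx]
    by_cases hco : IsCorner lam y
    · rw [level_eq_zero hco]; omega
    · have hy' : y ∈ peel lam := mem_peel_iff.2 ⟨hy, hco⟩
      rw [level_eq_succ h hy']
      exact Nat.succ_lt_succ (ih (peel_bound h) hy')

/-- The fused functional of a diagram as a product over its boxes by decreasing levels. -/
theorem exists_isFusion {n M : ℕ} {lam : YoungDiagram} (hlam : lam ≤ staircase n)
    (h : ∀ c ∈ lam, c.1 + c.2 < M) (t : ℚ) :
    ∃ l : List (ℕ × ℕ), l.Nodup ∧ (∀ c, c ∈ l ↔ c ∈ lam) ∧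
      l.Pairwise (fun x y => level lam y ≤ level lam x) ∧
      ∃ φ, IsFusion t (word n lam) φ ∧ ∀ f,
        φ f = (l.map fun c => yb (t + level lam c) (label n c)).prod f (word n ⊥) := by
  classical
  induction M generalizing lam t with
  | zero =>
    have e : lam = ⊥ := by
      refine YoungDiagram.ext (Finset.eq_empty_of_forall_notMem fun c hc => ?_)
      exact Nat.not_lt_zero _ (h c hc)
    subst e
    refine ⟨[], List.nodup_nil, by simp, List.Pairwise.nil, _, .base fun i hi => ?_, fun f => rfl⟩
    obtain ⟨c, hc, -⟩ := (valley_word_iff hlam).1 hi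
    exact YoungDiagram.notMem_bot _ hc.1
  | succ M ih =>
    obtain ⟨l, hl, hmem, hpw, φ, hφ, he⟩ := ih ((peel_le _).trans hlam) (peel_bound h) (t + 1)
    set C := (lam.cells.filter (IsCorner lam)).toList with hC
    have hmemC : ∀ c, c ∈ C ↔ IsCorner lam c := fun c => by
      rw [hC, Finset.mem_toList, Finset.mem_filter, YoungDiagram.mem_cells]
      exact ⟨fun hc => hc.2, fun hc => ⟨hc.1, hc⟩⟩
    rw [word_peel hlam] at hφ
    have hS : (C.map fun c => (label n c : ℤ)).Nodup := by
      refine List.Nodup.map_on (fun x hx y hy hxy => ?_) (Finset.nodup_toList _)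
      rw [hmemC] at hx hy
      rw [(label_cast hlam hx.1).1, (label_cast hlam hy.1).1] at hxy
      rw [isCorner_iff] at hx hy
      have a1 := lam.rowLen_anti (x.1 + 1) y.1
      have a2 := lam.rowLen_anti (y.1 + 1) x.1
      exact Prod.ext (by omega) (by omega)
    have hlev : ∀ c ∈ l, level lam c = level (peel lam) c + 1 := fun c hc =>
      level_eq_succ h ((hmem c).1 hc)
    have hlev0 : ∀ c ∈ C, level lam c = 0 := fun c hc => level_eq_zero ((hmemC c).1 hc)
    -- Corners go to the right end because operators now act on `f`, so the last box applied to the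
    -- monomial acts first.
    refine ⟨l ++ C, ?_, fun c => ?_, ?_, _, hφ.step hS fun i => ?_, fun f => ?_⟩
    · refine hl.append (Finset.nodup_toList _) fun c hc hc' => ?_
      exact (mem_peel_iff.1 ((hmem c).1 hc)).2 ((hmemC c).1 hc')
    · rw [List.mem_append, hmem, hmemC, mem_peel_iff]
      unfold IsCorner; tauto
    · refine List.pairwise_append.2 ⟨?_, ?_, ?_⟩
      · refine hpw.imp_of_mem fun hx hy hxy => ?_
        rw [hlev _ hx, hlev _ hy]; omega
      · refine List.pairwise_of_forall_mem_list fun x hx y hy => ?_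
        rw [hlev0 _ hx, hlev0 _ hy]
      · intro x hx y hy
        rw [hlev0 _ hy]; omega
    · rw [valley_word_iff hlam, List.mem_map]
      simp only [hmemC]
    · have e1 : (l.map fun c => yb (t + level lam c) (label n c)) =
          l.map fun c => yb (t + 1 + level (peel lam) c) (label n c) :=
        List.map_congr_left fun c hc => by rw [hlev c hc]; push_cast; ring_nf
      have e2 : (C.map fun c => yb (t + level lam c) (label n c)) =
          (C.map fun c => (label n c : ℤ)).map (yb t) := by
        rw [List.map_map]
        exact List.map_congr_left fun c hc => by rw [hlev0 c hc]; simp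
      rw [LinearMap.comp_apply, he, List.map_append, List.prod_append, e1, e2,
        Module.End.mul_apply]
      rfl

/-- Two orders of the factors of a product give the same result if any two factors commute or are
put in the same order by a rank function. -/
theorem prod_map_eq_of_rank {ι M : Type*} [Monoid M] (g : ι → M) (rank : ι → ℕ) {l₁ l₂ : List ι}
    (hp : l₁.Perm l₂)
    (h₁ : l₁.Pairwise fun x y => Commute (g x) (g y) ∨ rank y < rank x)
    (h₂ : l₂.Pairwise fun x y => Commute (g x) (g y) ∨ rank y < rank x) :
    (l₁.map g).prod = (l₂.map g).prod := by
  induction l₁ generalizing l₂ with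
  | nil => rw [hp.nil_eq]
  | cons a l₁ ih =>
    obtain ⟨s, u, rfl⟩ := List.append_of_mem (hp.subset List.mem_cons_self)
    have hp' : l₁.Perm (s ++ u) := (hp.trans List.perm_middle).cons_inv
    rw [List.pairwise_cons] at h₁
    rw [List.pairwise_append, List.pairwise_cons] at h₂
    obtain ⟨hs, ⟨-, hu⟩, hsu⟩ := h₂
    have hc : Commute (g a) (s.map g).prod := by
      refine Commute.list_prod_right _ _ fun x hx => ?_
      obtain ⟨b, hb, rfl⟩ := List.mem_map.1 hx
      have c1 := h₁.1 b (hp'.symm.subset (List.mem_append_left _ hb))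
      have c2 := hsu b hb a List.mem_cons_self
      rcases c1 with c1 | c1
      · exact c1
      · rcases c2 with c2 | c2
        · exact c2.symm
        · omega
    rw [List.map_cons, List.prod_cons, ih hp' h₁.2 (List.pairwise_append.2
      ⟨hs, hu, fun x hx y hy => hsu x hx y (List.mem_cons_of_mem _ hy)⟩)]
    simp only [List.map_append, List.prod_append, List.map_cons, List.prod_cons]
    rw [← mul_assoc, hc.eq, mul_assoc]

theorem mem_rowReading {lam : YoungDiagram} {c : ℕ × ℕ} : c ∈ rowReading lam ↔ c ∈ lam := by
  obtain ⟨a, b⟩ := c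
  simp only [rowReading, List.mem_flatMap, List.mem_range, List.mem_map, Prod.mk.injEq]
  constructor
  · rintro ⟨i, -, j, hj, rfl, rfl⟩
    exact YoungDiagram.mem_iff_lt_rowLen.2 hj
  · intro h
    refine ⟨a, ?_, b, YoungDiagram.mem_iff_lt_rowLen.1 h, rfl, rfl⟩
    exact YoungDiagram.mem_iff_lt_colLen.1 (lam.up_left_mem le_rfl (Nat.zero_le b) h)

theorem pairwise_rowReading (lam : YoungDiagram) :
    (rowReading lam).Pairwise fun x y => x.1 < y.1 ∨ x.1 = y.1 ∧ x.2 < y.2 := by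
  unfold rowReading
  rw [List.pairwise_flatMap]
  refine ⟨fun i _ => ?_, ?_⟩
  · rw [List.pairwise_map]
    exact List.pairwise_lt_range.imp fun h => Or.inr ⟨rfl, h⟩
  · refine List.pairwise_lt_range.imp fun h x hx y hy => ?_
    obtain ⟨_, _, rfl⟩ := List.mem_map.1 hx
    obtain ⟨_, _, rfl⟩ := List.mem_map.1 hy
    exact Or.inl h

/-- The product of the operators of the boxes, read by successive rows, is a fused functional. -/
theorem isFusion_rowReading {n : ℕ} {lam : YoungDiagram} (hlam : lam ≤ staircase n) :
    ∃ φ, IsFusion 1 (word n lam) φ ∧ ∀ f, φ f =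
      ((rowReading lam).map fun c => yb (1 + level lam c) (label n c)).prod f (word n ⊥) := by
  have hb : ∀ c ∈ lam, c.1 + c.2 < n := fun c hc => by
    have := mem_staircase.1 (hlam hc); omega
  obtain ⟨l, hl, hmem, hpw, φ, hφ, he⟩ := exists_isFusion hlam hb 1
  refine ⟨φ, hφ, fun f => ?_⟩
  have hr := pairwise_rowReading lam
  have hnd : (rowReading lam).Nodup := hr.imp fun h => by rintro rfl; omega
  -- Operators can fail to commute only when their labels differ by 1. Their boxes are then
  -- comparable, and both readings put the smaller box, of higher level, first.
  have key : ∀ x ∈ lam, ∀ y ∈ lam,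
      Commute (yb (1 + level lam x) (label n x)) (yb (1 + level lam y) (label n y)) ∨
        (x ≤ y ∨ y ≤ x) ∧ x ≠ y := by
    intro x hx y hy
    have h1 := (label_cast hlam hx).1
    have h2 := (label_cast hlam hy).1
    rcases eq_or_ne (label n x) (label n y) with h3 | h3
    · rw [h3]; exact Or.inl (yb_commute_self _ _ _)
    by_cases h4 : (label n x : ℤ) + 2 ≤ label n y ∨ (label n y : ℤ) + 2 ≤ label n x
    · exact Or.inl (yb_commute _ _ h4)
    · right
      rw [Prod.le_def, Prod.le_def]
      exact ⟨by omega, by rintro rfl; exact h3 rfl⟩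
  rw [he, prod_map_eq_of_rank _ (level lam)
    ((List.perm_ext_iff_of_nodup hl hnd).2 fun c => by rw [hmem, mem_rowReading])]
  · refine hpw.imp_of_mem fun {x y} hx hy hxy => ?_
    rw [hmem] at hx hy
    rcases key x hx y hy with h | ⟨h | h, hne⟩
    · exact Or.inl h
    · exact Or.inr (level_lt hb hy h hne)
    · exact absurd (level_lt hb hx h hne.symm) (by omega)
  · refine hr.imp_of_mem fun {x y} hx hy hxy => ?_
    rw [mem_rowReading] at hx hy
    rcases key x hx y hy with h | ⟨h | h, hne⟩
    · exact Or.inl h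
    · exact Or.inr (level_lt hb hy h hne)
    · rw [Prod.le_def] at h; omega

/-! ### From the pairing of polynomials to functions of words -/

/-- The pairing as a linear map in its second argument. -/
noncomputable def pairingHom (f : Poly) : Poly →ₗ[ℚ] ℚ :=
  (MvPolynomial.basisMonomials ℕ ℚ).constr ℚ fun v => MvPolynomial.eval (fun i => (v i : ℚ)) f

theorem pairingHom_monomial (f : Poly) (v : ℕ →₀ ℕ) :
    pairingHom f (MvPolynomial.monomial v 1) = MvPolynomial.eval (fun i => (v i : ℚ)) f := by
  have := (MvPolynomial.basisMonomials ℕ ℚ).constr_basis ℚ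
    (fun v => MvPolynomial.eval (fun i => (v i : ℚ)) f) v
  rwa [MvPolynomial.coe_basisMonomials] at this

theorem pairing_eq_pairingHom (f g : Poly) : pairing f g = pairingHom f g := by
  conv_rhs => rw [g.as_sum, map_sum]
  refine Finset.sum_congr rfl fun v _ => ?_
  rw [← pairingHom_monomial, ← smul_eq_mul, ← map_smul, MvPolynomial.smul_monomial, smul_eq_mul,
    mul_one]

theorem pairingHom_simpleAct (i : ℕ) (f g : Poly) :
    pairingHom f (simpleAct i g) = pairingHom (simpleAct i f) g := by
  have h : pairingHom f ∘ₗ (MvPolynomial.rename (Equiv.swap i (i + 1))).toLinearMap =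
      pairingHom (simpleAct i f) := by
    refine (MvPolynomial.basisMonomials ℕ ℚ).ext fun v => ?_
    rw [MvPolynomial.coe_basisMonomials, LinearMap.comp_apply, AlgHom.toLinearMap_apply,
      MvPolynomial.rename_monomial, pairingHom_monomial, pairingHom_monomial]
    unfold simpleAct
    rw [MvPolynomial.eval_rename]
    congr 2
    funext k
    rw [Finsupp.mapDomain_equiv_apply, Equiv.symm_swap]
    rfl
  exact LinearMap.congr_fun h g

/-- The function on words defined by a polynomial. -/
noncomputable def toWordFun : Poly →ₗ[ℚ] WordFun where
  toFun f v := MvPolynomial.eval (fun k : ℕ => if 1 ≤ k then bit (v k) else 0) f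
  map_add' f g := by ext v; simp
  map_smul' c f := by ext v; simp

theorem toWordFun_apply (f : Poly) (v : Word) :
    toWordFun f v = MvPolynomial.eval (fun k : ℕ => if 1 ≤ k then bit (v k) else 0) f := rfl

/-- The variable of index 0 is evaluated at 0, in accordance with exponent vectors on `1, 2, ...`,
whereas words have letter 1 at position 0 in the applications; hence the swap must avoid index 0. -/
theorem toWordFun_simpleAct {i : ℕ} (hi : 1 ≤ i) (f : Poly) :
    toWordFun (simpleAct i f) = transp i (toWordFun f) := by
  funext v
  rw [transp_apply, toWordFun_apply, toWordFun_apply]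
  unfold simpleAct
  rw [MvPolynomial.eval_rename]
  congr 2
  funext k
  rw [Function.comp_apply, Equiv.swap_apply_def]
  simp only [swapAt_apply]
  split_ifs <;> first | omega | (push_cast; congr)

theorem prod_X_eq (s : Finset ℕ) :
    (∏ i ∈ s, MvPolynomial.X i : Poly) = MvPolynomial.monomial (∑ i ∈ s, Finsupp.single i 1) 1 := by
  rw [MvPolynomial.monomial_sum_one]
  rfl

theorem pairingHom_base (n : ℕ) (f : Poly) :
    pairingHom f (∏ i ∈ Finset.Icc 1 n, MvPolynomial.X i) = toWordFun f (word n ⊥) := by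
  rw [prod_X_eq, pairingHom_monomial, toWordFun_apply, word_bot]
  congr 2
  funext k
  simp only [Finsupp.finsetSum_apply, Finsupp.single_apply, Finset.sum_ite_eq', Finset.mem_Icc, bit,
    decide_eq_true_eq, Nat.cast_le]
  split_ifs <;> first | omega | simp

/-- Each operator is self-adjoint. The fold applies the head of the list first to `g`, so the head
acts last on `f`: this is the order of the list product. -/
theorem pairingHom_foldl (n : ℕ) (a : ℕ × ℕ → ℚ) {l : List (ℕ × ℕ)} (hl : ∀ c ∈ l, 1 ≤ label n c)
    (f g : Poly) :
    ∃ f' : Poly, toWordFun f' =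
        (l.map fun c => yb (a c) (label n c)).prod (toWordFun f) ∧
      pairingHom f (l.foldl (fun g c => simpleAct (label n c) g + MvPolynomial.C (1 / a c) * g) g) =
        pairingHom f' g := by
  induction l generalizing g with
  | nil => exact ⟨f, rfl, rfl⟩
  | cons c l ih =>
    obtain ⟨f', h1, h2⟩ := ih (fun d hd => hl d (List.mem_cons_of_mem _ hd))
      (simpleAct (label n c) g + MvPolynomial.C (1 / a c) * g)
    refine ⟨simpleAct (label n c) f' + (1 / a c) • f', ?_, ?_⟩
    · rw [map_add, map_smul, toWordFun_simpleAct (hl c List.mem_cons_self), h1]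
      rfl
    · have e : ∀ g, pairingHom (simpleAct (label n c) f' + (1 / a c) • f') g =
          pairingHom (simpleAct (label n c) f') g + (1 / a c) * pairingHom f' g := by
        intro g
        rw [← pairing_eq_pairingHom, ← pairing_eq_pairingHom, ← pairing_eq_pairingHom]
        simp only [pairing, map_add, MvPolynomial.smul_eval, Finset.mul_sum,
          ← Finset.sum_add_distrib]
        exact Finset.sum_congr rfl fun v _ => by ring
      rw [List.foldl_cons, h2, map_add, pairingHom_simpleAct, MvPolynomial.C_mul', map_smul, e,
        smul_eq_mul]

theorem pairing_KLx {n : ℕ} {lam : YoungDiagram} (hlam : lam ≤ staircase n) :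
    ∃ φ, IsFusion 1 (word n lam) φ ∧ ∀ f, pairing f (KLx n lam) = φ (toWordFun f) := by
  obtain ⟨φ, hφ, he⟩ := isFusion_rowReading hlam
  refine ⟨φ, hφ, fun f => ?_⟩
  obtain ⟨f', h1, h2⟩ := pairingHom_foldl n (fun c => 1 + (level lam c : ℚ))
    (l := rowReading lam) (fun c hc => (label_cast hlam (mem_rowReading.1 hc)).2) f
    (∏ i ∈ Finset.Icc 1 n, MvPolynomial.X i)
  rw [pairing_eq_pairingHom, he, ← h1, ← pairingHom_base, ← h2]
  rfl

/-! ### The recursion from the staircase, and duality -/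

theorem rowLen_staircase (n r : ℕ) : (staircase n).rowLen r = n - r - 1 := by
  refine eq_of_forall_lt_iff fun j => ?_
  rw [← YoungDiagram.mem_iff_lt_rowLen, mem_staircase]
  simp only
  omega

theorem word_staircase_succ (n : ℕ) :
    word (n + 1) (staircase (n + 1)) = ins (2 * n + 1) (word n (staircase n)) := by
  funext k
  rw [Bool.eq_iff_iff, word_eq_true]
  simp only [ins, rowLen_staircase]
  have h : ∀ (m : ℕ) (k : ℤ), (∃ r < m, k = (m : ℤ) - r + (m - r - 1 : ℕ)) ↔
      ∃ r < m, k = 2 * (r : ℤ) + 1 := by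
    intro m k
    constructor
    · rintro ⟨r, hr, h⟩; exact ⟨m - 1 - r, by omega, by omega⟩
    · rintro ⟨r, hr, h⟩; exact ⟨m - 1 - r, by omega, by omega⟩
  rw [h]
  split_ifs with h1 h2 h3
  · rw [word_eq_true]
    simp only [rowLen_staircase]
    rw [h]
    refine or_congr_right ⟨fun ⟨r, hr, e⟩ => ⟨r, by omega, e⟩, fun ⟨r, hr, e⟩ => ⟨r, by omega, e⟩⟩
  · simp only [iff_true]
    exact Or.inr ⟨n, by omega, h2⟩
  · simp only [iff_false]
    rintro (h4 | ⟨r, hr, h4⟩) <;> omega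
  · rw [word_eq_true]
    simp only [rowLen_staircase]
    rw [h]
    constructor
    · rintro (h4 | ⟨r, hr, h4⟩) <;> omega
    · rintro (h4 | ⟨r, hr, h4⟩) <;> omega

theorem isLink_staircase (n : ℕ) : IsLink n (word n (staircase n))
    (toWordFun (∏ k ∈ Finset.range n, (MvPolynomial.X (2 * k + 1) - MvPolynomial.X (2 * k + 2)))) := by
  have hw : ∀ (n : ℕ) (v : Word), toWordFun (∏ k ∈ Finset.range n,
      (MvPolynomial.X (2 * k + 1) - MvPolynomial.X (2 * k + 2))) v =
      ∏ k ∈ Finset.range n, (bit (v (2 * k + 1)) - bit (v (2 * k + 2))) := by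
    intro n v
    rw [toWordFun_apply, map_prod]
    refine Finset.prod_congr rfl fun k _ => ?_
    simp
  induction n with
  | zero =>
    have e1 : word 0 (staircase 0) = fun k => decide (k ≤ 0) := by
      funext k; simp [word]
    rw [e1]
    convert IsLink.base using 1
    funext v
    rw [hw]; rfl
  | succ n ih =>
    rw [word_staircase_succ]
    convert IsLink.step ih (p := 2 * n + 1) (by omega) le_rfl using 1
    funext v
    have e : ∀ k ∈ Finset.range n, (bit (del (2 * n + 1) v (2 * k + 1)) -
        bit (del (2 * n + 1) v (2 * k + 2))) = bit (v (2 * k + 1)) - bit (v (2 * k + 2)) := by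
      intro k hk
      rw [Finset.mem_range] at hk
      simp only [del]
      rw [if_pos (by omega), if_pos (by omega)]
    rw [hw, cup_apply, hw, Finset.prod_congr rfl e, Finset.prod_range_succ, mul_comm, add_assoc]
    rfl

theorem IsLKa.isLink {n : ℕ} {lam : YoungDiagram} {f : Poly} (h : IsLKa n lam f) :
    lam ≤ staircase n ∧ IsLink n (word n lam) (toWordFun f) := by
  induction h with
  | base => exact ⟨le_rfl, isLink_staircase n⟩
  | @step lam mu f c hf hc hins ih =>
    obtain ⟨hlam, hl⟩ := ih
    have hco := isCorner_of_insert hc hins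
    refine ⟨(le_of_insert hins).trans hlam, ?_⟩
    rw [word_insert hlam hc hins, map_sub, toWordFun_simpleAct (label_cast hlam hco.1).2]
    exact hl.tl ((valley_word_iff hlam).2 ⟨c, hco, rfl⟩)

/-- The duality between the two families. -/
theorem IsLKa.pairing_KLx {n : ℕ} {lam mu : YoungDiagram} (hmu : mu ≤ staircase n) {f : Poly}
    (h : IsLKa n lam f) : pairing f (KLx n mu) = if lam = mu then 1 else 0 := by
  obtain ⟨hlam, hl⟩ := h.isLink
  obtain ⟨φ, hφ, he⟩ := HankelKL.pairing_KLx hmu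
  obtain ⟨b1, b2⟩ := word_bounds hmu
  obtain ⟨d1, d2⟩ := hl.duality b1 b2 hφ
  rw [he]
  split_ifs with hlm
  · exact d1 (by rw [hlm])
  · exact d2 fun e => hlm (word_injective hlam hmu e)

/-! ### Dyck paths and the explicit link-pattern product -/

theorem mem_upSteps {n : ℕ} {lam : YoungDiagram} {p : ℕ} :
    p ∈ upSteps n lam ↔ 1 ≤ p ∧ word n lam p = true := by
  rw [word_eq_true]
  simp only [upSteps, Finset.mem_image, Finset.mem_range]
  constructor
  · rintro ⟨r, hr, rfl⟩
    exact ⟨by omega, Or.inr ⟨r, hr, by omega⟩⟩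
  · rintro ⟨h1, h2 | ⟨r, hr, h2⟩⟩
    · omega
    · exact ⟨r, hr, by omega⟩

theorem height_zero (n : ℕ) (lam : YoungDiagram) : height n lam 0 = 0 := rfl

theorem height_succ (n : ℕ) (lam : YoungDiagram) (k : ℕ) :
    height n lam (k + 1) = height n lam k + if k + 1 ∈ upSteps n lam then 1 else -1 := by
  unfold height
  rw [Finset.sum_Icc_succ_top (by omega)]

theorem height_pred (n : ℕ) (lam : YoungDiagram) {k : ℕ} (hk : 1 ≤ k) :
    height n lam k = height n lam (k - 1) + if k ∈ upSteps n lam then 1 else -1 := by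
  obtain ⟨k, rfl⟩ := Nat.exists_eq_add_of_le' hk
  exact height_succ n lam k

/-- Induction over the diagrams contained in the staircase, by removal of boxes. -/
theorem staircase_induction {n : ℕ} {P : YoungDiagram → Prop} (base : P (staircase n))
    (step : ∀ lam mu : YoungDiagram, ∀ c : ℕ × ℕ, lam ≤ staircase n → c ∉ mu →
      lam.cells = insert c mu.cells → P lam → P mu)
    {lam : YoungDiagram} (hlam : lam ≤ staircase n) : P lam := by
  induction hd : ((staircase n).cells \ lam.cells).card generalizing lam with
  | zero =>
    rw [Finset.card_eq_zero, Finset.sdiff_eq_empty_iff_subset] at hd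
    rwa [le_antisymm hlam fun c hc => hd hc]
  | succ d ih =>
    -- A missing box with least row plus column index has every smaller box in `lam`, so adding it
    -- gives a diagram.
    obtain ⟨c, hc, hmin⟩ := Finset.exists_min_image ((staircase n).cells \ lam.cells)
      (fun c => c.1 + c.2) (Finset.card_pos.1 (by omega))
    rw [Finset.mem_sdiff, YoungDiagram.mem_cells, YoungDiagram.mem_cells] at hc
    have hlow : ∀ x, x ≤ c → x = c ∨ x ∈ lam := by
      intro x hx
      by_contra hcon
      push Not at hcon
      have hxs : x ∈ staircase n := (staircase n).isLowerSet hx hc.1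
      have := hmin x (by
        rw [Finset.mem_sdiff, YoungDiagram.mem_cells, YoungDiagram.mem_cells]
        exact ⟨hxs, hcon.2⟩)
      obtain ⟨h1, h2⟩ := Prod.le_def.1 hx
      exact hcon.1 (Prod.ext (by omega) (by omega))
    let nu : YoungDiagram := ⟨insert c lam.cells, fun x y hyx hx => by
      rw [Finset.mem_coe, Finset.mem_insert, YoungDiagram.mem_cells] at hx ⊢
      rcases hx with rfl | hx
      · exact hlow y hyx
      · exact Or.inr (lam.isLowerSet hyx hx)⟩
    have hnu : nu ≤ staircase n := fun x hx => by
      have hx' : x ∈ insert c lam.cells := hx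
      rcases Finset.mem_insert.1 hx' with rfl | hx'
      · exact hc.1
      · exact hlam hx'
    refine step nu lam c hnu hc.2 rfl (ih hnu ?_)
    have hcd : c ∈ (staircase n).cells \ lam.cells := by
      rw [Finset.mem_sdiff]; exact hc
    have : (staircase n).cells \ nu.cells = ((staircase n).cells \ lam.cells).erase c := by
      ext x
      simp only [nu, Finset.mem_sdiff, Finset.mem_insert, Finset.mem_erase]
      tauto
    rw [this, Finset.card_erase_of_mem hcd, hd]
    rfl

/-- The effect on the up steps and on the heights of the removal of a box. -/
theorem upSteps_insert {n : ℕ} {lam mu : YoungDiagram} (hlam : lam ≤ staircase n) {c : ℕ × ℕ}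
    (hc : c ∉ mu) (h : lam.cells = insert c mu.cells) :
    1 ≤ label n c ∧ label n c + 1 ≤ 2 * n ∧
    label n c ∉ upSteps n lam ∧ label n c + 1 ∈ upSteps n lam ∧
      (∀ p, p ∈ upSteps n mu ↔ p = label n c ∨ p ∈ upSteps n lam ∧ p ≠ label n c + 1) ∧
      ∀ k, height n mu k = height n lam k + if k = label n c then 2 else 0 := by
  have hco := isCorner_of_insert hc h
  obtain ⟨v1, v2⟩ := (valley_word_iff hlam).2 ⟨c, hco, rfl⟩
  have hl1 := (label_cast hlam hco.1).2
  have hw := word_insert hlam hc h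
  have hb := (word_bounds hlam).2 (label n c + 1 : ℤ)
  rw [v2] at hb
  have m1 : label n c ∉ upSteps n lam := by rw [mem_upSteps, v1]; simp
  have m2 : label n c + 1 ∈ upSteps n lam := by
    rw [mem_upSteps]; exact ⟨by omega, by push_cast; exact v2⟩
  have m3 : ∀ p, p ∈ upSteps n mu ↔
      p = label n c ∨ p ∈ upSteps n lam ∧ p ≠ label n c + 1 := by
    intro p
    rw [mem_upSteps, mem_upSteps, hw, swapAt_apply]
    split_ifs with h1 h2
    · rw [v2]; simp only [and_true]; omega
    · rw [v1]; simp only [Bool.false_eq_true, and_false, false_iff]; omega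
    · constructor
      · intro h3; exact Or.inr ⟨h3, by omega⟩
      · rintro (h3 | h3)
        · omega
        · exact h3.1
  refine ⟨hl1, by by_contra hcon; exact absurd (hb (by omega)) (by simp), m1, m2, m3, fun k => ?_⟩
  induction k with
  | zero => rw [height_zero, height_zero, if_neg (by omega)]; rfl
  | succ k ih =>
    rw [height_succ, height_succ, ih]
    simp only [m3]
    by_cases h1 : k + 1 = label n c
    · rw [h1] ; simp [m1]; omega
    · by_cases h2 : k = label n c
      · rw [h2]; simp [m2]; omega
      · simp [h1, h2]

theorem mem_upSteps_staircase {n p : ℕ} : p ∈ upSteps n (staircase n) ↔ ∃ k < n, p = 2 * k + 1 := by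
  simp only [upSteps, Finset.mem_image, Finset.mem_range, rowLen_staircase]
  constructor
  · rintro ⟨r, hr, h⟩; exact ⟨n - 1 - r, by omega, by omega⟩
  · rintro ⟨r, hr, h⟩; exact ⟨n - 1 - r, by omega, by omega⟩

theorem height_staircase {n k : ℕ} (hk : k ≤ 2 * n) : height n (staircase n) k = (k % 2 : ℕ) := by
  induction k with
  | zero => rfl
  | succ k ih =>
    rw [height_succ, ih (by omega)]
    split_ifs with h <;> rw [mem_upSteps_staircase] at h
    · omega
    · have : ¬ (k + 1) % 2 = 1 := fun h' => h ⟨k / 2, by omega, by omega⟩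
      omega

/-- The staircase path alternates between heights 0 and 1, and removing a box only raises the path
at one interior point. -/
theorem height_nonneg {n : ℕ} {lam : YoungDiagram} (hlam : lam ≤ staircase n) :
    (∀ k ≤ 2 * n, 0 ≤ height n lam k) ∧ height n lam (2 * n) = 0 := by
  refine staircase_induction (P := fun lam => (∀ k ≤ 2 * n, 0 ≤ height n lam k) ∧
    height n lam (2 * n) = 0) ⟨fun k hk => ?_, ?_⟩ (fun lam mu c hlam hc h ih => ?_) hlam
  · rw [height_staircase hk]; positivity
  · rw [height_staircase le_rfl]; simp
  · obtain ⟨-, h1, -, -, -, h2⟩ := upSteps_insert hlam hc h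
    refine ⟨fun k hk => ?_, ?_⟩
    · rw [h2]; have := ih.1 k hk; split_ifs <;> omega
    · rw [h2, ih.2, if_neg (by omega)]; rfl

/-- The partner is the last step starting at height at most that after step `i`; nonnegativity of
the path makes step 1 a candidate. -/
theorem exists_linked_left {n : ℕ} {lam : YoungDiagram} (hlam : lam ≤ staircase n) {i : ℕ}
    (hi : 1 ≤ i) (hi' : i ≤ 2 * n) (hm : i ∉ upSteps n lam) : ∃ a ≥ 1, Linked n lam a i := by
  classical
  have h0 := (height_nonneg hlam).1 i hi'
  set P : ℕ → Prop := fun a => 1 ≤ a ∧ height n lam (a - 1) ≤ height n lam i with hP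
  have hspec : P (Nat.findGreatest P i) :=
    Nat.findGreatest_spec hi ⟨le_rfl, by rw [Nat.sub_self, height_zero]; exact h0⟩
  have hgr : ∀ k, Nat.findGreatest P i < k → k ≤ i → ¬ P k := fun k =>
    Nat.findGreatest_is_greatest
  have hle := Nat.findGreatest_le (P := P) i
  generalize Nat.findGreatest P i = a at *
  obtain ⟨ha, hspec⟩ := hspec
  have hp := height_pred n lam hi
  rw [if_neg hm] at hp
  have hne : a ≠ i := by rintro rfl; omega
  have hlt : ∀ k ∈ Finset.Ico a i, height n lam i < height n lam k := by
    intro k hk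
    rw [Finset.mem_Ico] at hk
    have := hgr (k + 1) (by omega) (by omega)
    simp only [hP, Nat.add_sub_cancel] at this
    omega
  have hp' := height_pred n lam ha
  have hl := hlt a (Finset.mem_Ico.2 ⟨le_rfl, by omega⟩)
  have hu : a ∈ upSteps n lam := by
    by_contra hcon
    rw [if_neg hcon] at hp'; omega
  rw [if_pos hu] at hp'
  refine ⟨a, ha, by omega, hu, by omega, fun k hk => ?_⟩
  have := hlt k hk
  omega

theorem exists_linked_right {n : ℕ} {lam : YoungDiagram} (hlam : lam ≤ staircase n) {j : ℕ}
    (hj : 1 ≤ j) (hj' : j ≤ 2 * n) (hm : j ∈ upSteps n lam) : ∃ b ≤ 2 * n, Linked n lam j b := by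
  obtain ⟨h1, h2⟩ := height_nonneg hlam
  have h3 := h1 (j - 1) (by omega)
  have hp := height_pred n lam hj
  rw [if_pos hm] at hp
  have hex : ∃ b, j < b ∧ height n lam b ≤ height n lam (j - 1) := by
    refine ⟨2 * n, lt_of_le_of_ne hj' ?_, by omega⟩
    rintro rfl
    omega
  classical
  have hmin : ∀ m, m < Nat.find hex → ¬ (j < m ∧ height n lam m ≤ height n lam (j - 1)) :=
    fun m => Nat.find_min hex
  have hle : Nat.find hex ≤ 2 * n :=
    Nat.find_min' hex ⟨lt_of_le_of_ne hj' (by rintro rfl; omega), by omega⟩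
  obtain ⟨hb1, hb2⟩ := Nat.find_spec hex
  generalize Nat.find hex = b at *
  have hlt : ∀ k ∈ Finset.Ico j b, height n lam (j - 1) < height n lam k := by
    intro k hk
    rw [Finset.mem_Ico] at hk
    rcases eq_or_lt_of_le hk.1 with rfl | h
    · omega
    · have := hmin k hk.2
      omega
  have hl := hlt (b - 1) (Finset.mem_Ico.2 ⟨by omega, by omega⟩)
  have hp' := height_pred n lam (k := b) (by omega)
  refine ⟨b, hle, hb1, hm, ?_, hlt⟩
  split_ifs at hp' <;> omega

theorem Linked.right_unique {n : ℕ} {lam : YoungDiagram} {i j j' : ℕ} (h : Linked n lam i j)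
    (h' : Linked n lam i j') : j = j' := by
  obtain ⟨h1, -, h3, h4⟩ := h
  obtain ⟨h1', -, h3', h4'⟩ := h'
  rcases lt_trichotomy j j' with h | h | h
  · have := h4' j (Finset.mem_Ico.2 ⟨h1.le, h⟩); omega
  · exact h
  · have := h4 j' (Finset.mem_Ico.2 ⟨h1'.le, h⟩); omega

theorem Linked.left_unique {n : ℕ} {lam : YoungDiagram} {i i' j : ℕ} (hi : 1 ≤ i) (hi' : 1 ≤ i')
    (h : Linked n lam i j) (h' : Linked n lam i' j) : i = i' := by
  obtain ⟨h1, -, h3, h4⟩ := h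
  obtain ⟨h1', -, h3', h4'⟩ := h'
  rcases lt_trichotomy i i' with h | h | h
  · have := h4 (i' - 1) (Finset.mem_Ico.2 ⟨by omega, by omega⟩); omega
  · exact h
  · have := h4' (i - 1) (Finset.mem_Ico.2 ⟨by omega, by omega⟩); omega

theorem Linked.not_mem_right {n : ℕ} {lam : YoungDiagram} {i j : ℕ} (h : Linked n lam i j) :
    j ∉ upSteps n lam := by
  obtain ⟨h1, h2, h3, h4⟩ := h
  have h5 := h4 (j - 1) (Finset.mem_Ico.2 ⟨by omega, by omega⟩)
  have h6 := height_pred n lam (k := j) (by omega)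
  intro hj
  rw [if_pos hj] at h6
  omega

/-- The links of a diagram from which a box has been removed. -/
theorem linked_insert_iff {n : ℕ} {lam mu : YoungDiagram} (hlam : lam ≤ staircase n)
    {c : ℕ × ℕ} (hc : c ∉ mu) (h : lam.cells = insert c mu.cells) {a b : ℕ} (ha1 : 1 ≤ a)
    (ha : Linked n lam a (label n c)) (hb : Linked n lam (label n c + 1) b) {p q : ℕ} (hp : 1 ≤ p) :
    Linked n mu p q ↔ (p = label n c ∧ q = label n c + 1) ∨ (p = a ∧ q = b) ∨
      (Linked n lam p q ∧ q ≠ label n c ∧ p ≠ label n c + 1) := by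
  obtain ⟨i1, i2, u1, u2, u3, hh⟩ := upSteps_insert hlam hc h
  generalize label n c = i at *
  have g1 := height_pred n lam i1
  have g2 := height_succ n lam i
  rw [if_neg u1] at g1
  rw [if_pos u2] at g2
  obtain ⟨a1, a2, a3, a4⟩ := id ha
  obtain ⟨b1, b2, b3, b4⟩ := id hb
  rw [Nat.add_sub_cancel] at b3 b4
  have hai : ∀ k, a ≤ k → k < i → height n lam i < height n lam k := fun k h1 h2 => by
    have := a4 k (Finset.mem_Ico.2 ⟨h1, h2⟩); omega
  have hbi : ∀ k, i + 1 ≤ k → k < b → height n lam i < height n lam k := fun k h1 h2 =>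
    b4 k (Finset.mem_Ico.2 ⟨h1, h2⟩)
  constructor
  · intro hL
    obtain ⟨l1, l2, l3, l4⟩ := id hL
    rw [u3] at l2
    simp only [hh] at l3 l4
    rcases l2 with rfl | ⟨l2, hpi⟩
    · left
      refine ⟨rfl, ?_⟩
      by_contra hq
      have := l4 (p + 1) (Finset.mem_Ico.2 ⟨by omega, by omega⟩)
      rw [if_neg (by omega), if_neg (by omega)] at this
      omega
    · right
      have hpi' : p ≠ i := by rintro rfl; exact u1 l2
      rw [if_neg (by omega : ¬ p - 1 = i)] at l3 l4
      have hq : q ≠ i := by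
        rintro rfl
        have := l4 (q - 1) (Finset.mem_Ico.2 ⟨by omega, by omega⟩)
        rw [if_neg (by omega)] at this
        rw [if_pos rfl] at l3
        omega
      rw [if_neg hq] at l3
      -- The two paths differ only at `i`. If the link of `mu` is not one of `lam`, the path of
      -- `lam` touches the starting level at `i`, which splits it into the links `(p, i)` and `(i +
      -- 1, q)`.
      by_cases hall : ∀ k ∈ Finset.Ico p q, height n lam (p - 1) < height n lam k
      · exact Or.inr ⟨⟨l1, l2, by omega, hall⟩, hq, hpi⟩
      · left
        push Not at hall
        obtain ⟨k, hk, hle⟩ := hall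
        have h1 := l4 k hk
        have hki : k = i := by
          by_contra hki
          rw [if_neg hki] at h1
          omega
        subst hki
        rw [Finset.mem_Ico] at hk
        have h2 := l4 (k - 1) (Finset.mem_Ico.2 ⟨by omega, by omega⟩)
        rw [if_neg (by omega)] at h2
        rw [if_pos rfl] at h1
        have hL1 : Linked n lam p k := by
          refine ⟨by omega, l2, by omega, fun m hm => ?_⟩
          rw [Finset.mem_Ico] at hm
          have := l4 m (Finset.mem_Ico.2 ⟨by omega, by omega⟩)
          rw [if_neg (by omega)] at this
          omega
        have hL2 : Linked n lam (k + 1) q := by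
          refine ⟨?_, u2, by rw [Nat.add_sub_cancel]; omega, fun m hm => ?_⟩
          · refine lt_of_le_of_ne hk.2 ?_
            rintro rfl
            omega
          · rw [Finset.mem_Ico] at hm
            have := l4 m (Finset.mem_Ico.2 ⟨by omega, by omega⟩)
            rw [if_neg (by omega)] at this
            rw [Nat.add_sub_cancel]
            omega
        exact ⟨hL1.left_unique hp ha1 ha, hL2.right_unique hb⟩
  · rintro (⟨rfl, rfl⟩ | ⟨rfl, rfl⟩ | ⟨⟨l1, l2, l3, l4⟩, hq, hp'⟩)
    · refine ⟨by omega, (u3 _).2 (Or.inl rfl), ?_, fun k hk => ?_⟩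
      · rw [hh, hh, if_neg (by omega), if_neg (by omega)]; omega
      · rw [Finset.mem_Ico] at hk
        obtain rfl : k = p := by omega
        rw [hh, hh, if_neg (by omega), if_pos rfl]; omega
    · refine ⟨by omega, (u3 _).2 (Or.inr ⟨a2, by omega⟩), ?_, fun k hk => ?_⟩
      · rw [hh, hh, if_neg (by omega), if_neg (by omega)]; omega
      · rw [Finset.mem_Ico] at hk
        rw [hh, hh, if_neg (by omega)]
        split_ifs with hk'
        · subst hk'; omega
        · rcases lt_or_gt_of_ne hk' with hk' | hk'
          · have := hai k hk.1 hk'; omega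
          · have := hbi k hk' hk.2; omega
    · have hpi : p ≠ i := by rintro rfl; exact u1 l2
      refine ⟨l1, (u3 _).2 (Or.inr ⟨l2, hp'⟩), ?_, fun k hk => ?_⟩
      · rw [hh, hh, if_neg hq, if_neg (by omega)]; omega
      · have := l4 k hk
        rw [hh, hh, if_neg (by omega)]
        split_ifs <;> omega

theorem mem_links {n : ℕ} {lam : YoungDiagram} {p : ℕ × ℕ} :
    p ∈ (Finset.Icc 1 (2 * n) ×ˢ Finset.Icc 1 (2 * n)).filter (fun p => Linked n lam p.1 p.2) ↔
      ((1 ≤ p.1 ∧ p.1 ≤ 2 * n) ∧ 1 ≤ p.2 ∧ p.2 ≤ 2 * n) ∧ Linked n lam p.1 p.2 := by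
  rw [Finset.mem_filter, Finset.mem_product, Finset.mem_Icc, Finset.mem_Icc]

/-- The removal of a box acts on link-pattern products by `s_i - 1`. -/
theorem linkProduct_insert {n : ℕ} {lam mu : YoungDiagram} (hlam : lam ≤ staircase n)
    {c : ℕ × ℕ} (hc : c ∉ mu) (h : lam.cells = insert c mu.cells) :
    simpleAct (label n c) (linkProduct n lam) - linkProduct n lam = linkProduct n mu := by
  obtain ⟨i1, i2, u1, u2, -, -⟩ := upSteps_insert hlam hc h
  obtain ⟨a, ha1, ha⟩ := exists_linked_left hlam i1 (by omega) u1
  obtain ⟨b, hb1, hb⟩ := exists_linked_right hlam (by omega) i2 u2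
  have hins := fun {p q : ℕ} (hp : 1 ≤ p) => linked_insert_iff hlam hc h ha1 ha hb (q := q) hp
  generalize label n c = i at *
  have hai := ha.1
  have hib := hb.1
  set L := (Finset.Icc 1 (2 * n) ×ˢ Finset.Icc 1 (2 * n)).filter
    (fun p => Linked n lam p.1 p.2) with hL
  set M := (Finset.Icc 1 (2 * n) ×ˢ Finset.Icc 1 (2 * n)).filter
    (fun p => Linked n mu p.1 p.2) with hM
  have hLa : (a, i) ∈ L := mem_links.2 ⟨by simp only; omega, ha⟩
  have hLb : (i + 1, b) ∈ L.erase (a, i) := Finset.mem_erase.2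
    ⟨by rw [ne_eq, Prod.mk.injEq]; omega, mem_links.2 ⟨by simp only; omega, hb⟩⟩
  have hMi : (i, i + 1) ∈ M := mem_links.2 ⟨by simp only; omega, (hins i1).2 (Or.inl ⟨rfl, rfl⟩)⟩
  have hMa : (a, b) ∈ M.erase (i, i + 1) := Finset.mem_erase.2
    ⟨by rw [ne_eq, Prod.mk.injEq]; omega,
      mem_links.2 ⟨by simp only; omega, (hins ha1).2 (Or.inr (Or.inl ⟨rfl, rfl⟩))⟩⟩
  have hR : ∀ p ∈ (L.erase (a, i)).erase (i + 1, b),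
      (p.1 ≠ i ∧ p.1 ≠ i + 1) ∧ p.2 ≠ i ∧ p.2 ≠ i + 1 := by
    rintro ⟨p, q⟩ hp
    rw [Finset.mem_erase, Finset.mem_erase, mem_links] at hp
    obtain ⟨h1, h2, h3, h4⟩ := hp
    simp only [ne_eq, Prod.mk.injEq] at h1 h2 h3 h4 ⊢
    refine ⟨⟨?_, ?_⟩, ?_, ?_⟩
    · rintro rfl; exact u1 h4.2.1
    · rintro rfl; exact h1 ⟨rfl, h4.right_unique hb⟩
    · rintro rfl; exact h2 ⟨h4.left_unique (by omega) ha1 ha, rfl⟩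
    · rintro rfl; exact h4.not_mem_right u2
  have hLM : (L.erase (a, i)).erase (i + 1, b) = (M.erase (i, i + 1)).erase (a, b) := by
    ext ⟨p, q⟩
    constructor
    · intro hp
      obtain ⟨⟨r1, r2⟩, r3, r4⟩ := hR _ hp
      rw [Finset.mem_erase, Finset.mem_erase, mem_links] at hp ⊢
      obtain ⟨h1, h2, h3, h4⟩ := hp
      simp only [ne_eq, Prod.mk.injEq] at *
      refine ⟨?_, by omega, h3, (hins h3.1.1).2 (Or.inr (Or.inr ⟨h4, r3, r2⟩))⟩
      rintro ⟨rfl, rfl⟩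
      exact r3 (h4.right_unique ha)
    · intro hp
      rw [Finset.mem_erase, Finset.mem_erase, mem_links] at hp ⊢
      obtain ⟨h1, h2, h3, h4⟩ := hp
      simp only [ne_eq, Prod.mk.injEq] at *
      rcases (hins h3.1.1).1 h4 with h5 | h5 | ⟨h5, h6, h7⟩
      · exact absurd h5 h2
      · exact absurd h5 h1
      · exact ⟨by omega, by omega, h3, h5⟩
  have hLp : linkProduct n lam = (MvPolynomial.X a - MvPolynomial.X i) *
      ((MvPolynomial.X (i + 1) - MvPolynomial.X b) *
      ∏ p ∈ (L.erase (a, i)).erase (i + 1, b), (MvPolynomial.X p.1 - MvPolynomial.X p.2)) := by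
    rw [Finset.mul_prod_erase (L.erase (a, i))
      (fun p => (MvPolynomial.X p.1 - MvPolynomial.X p.2 : Poly)) hLb,
      Finset.mul_prod_erase L (fun p => (MvPolynomial.X p.1 - MvPolynomial.X p.2 : Poly)) hLa]
    rfl
  have hMp : linkProduct n mu = (MvPolynomial.X i - MvPolynomial.X (i + 1)) *
      ((MvPolynomial.X a - MvPolynomial.X b) *
      ∏ p ∈ (M.erase (i, i + 1)).erase (a, b), (MvPolynomial.X p.1 - MvPolynomial.X p.2)) := by
    rw [Finset.mul_prod_erase (M.erase (i, i + 1))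
      (fun p => (MvPolynomial.X p.1 - MvPolynomial.X p.2 : Poly)) hMa,
      Finset.mul_prod_erase M (fun p => (MvPolynomial.X p.1 - MvPolynomial.X p.2 : Poly)) hMi]
    rfl
  have hinv : MvPolynomial.rename (Equiv.swap i (i + 1))
      (∏ p ∈ (L.erase (a, i)).erase (i + 1, b), (MvPolynomial.X p.1 - MvPolynomial.X p.2) : Poly) =
      ∏ p ∈ (L.erase (a, i)).erase (i + 1, b), (MvPolynomial.X p.1 - MvPolynomial.X p.2) := by
    rw [map_prod]
    refine Finset.prod_congr rfl fun p hp => ?_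
    obtain ⟨⟨r1, r2⟩, r3, r4⟩ := hR p hp
    rw [map_sub, MvPolynomial.rename_X, MvPolynomial.rename_X,
      Equiv.swap_apply_of_ne_of_ne r1 r2, Equiv.swap_apply_of_ne_of_ne r3 r4]
  rw [hLp, hMp, ← hLM]
  unfold simpleAct
  rw [map_mul, map_mul, hinv, map_sub, map_sub, MvPolynomial.rename_X, MvPolynomial.rename_X,
    MvPolynomial.rename_X, MvPolynomial.rename_X, Equiv.swap_apply_left, Equiv.swap_apply_right,
    Equiv.swap_apply_of_ne_of_ne (by omega : a ≠ i) (by omega),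
    Equiv.swap_apply_of_ne_of_ne (by omega : b ≠ i) (by omega)]
  -- The Plücker relation `(a - i')(i - b) - (a - i)(i' - b) = (i - i')(a - b)`, where `i'` stands
  -- for the variable of index `i + 1`.
  ring

theorem linked_staircase_iff {n p q : ℕ} (hp : 1 ≤ p) (hq : q ≤ 2 * n) :
    Linked n (staircase n) p q ↔ ∃ k < n, p = 2 * k + 1 ∧ q = 2 * k + 2 := by
  constructor
  · rintro ⟨h1, h2, h3, h4⟩
    obtain ⟨k, hk, rfl⟩ := mem_upSteps_staircase.1 h2
    refine ⟨k, hk, rfl, ?_⟩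
    by_contra hne
    have := h4 (2 * k + 2) (Finset.mem_Ico.2 ⟨by omega, by omega⟩)
    rw [height_staircase (by omega), height_staircase (by omega)] at this
    omega
  · rintro ⟨k, hk, rfl, rfl⟩
    refine ⟨by omega, mem_upSteps_staircase.2 ⟨k, hk, rfl⟩, ?_, fun m hm => ?_⟩
    · rw [height_staircase (by omega), height_staircase (by omega)]; omega
    · rw [Finset.mem_Ico] at hm
      rw [height_staircase (by omega), height_staircase (by omega)]; omega

theorem linkProduct_staircase (n : ℕ) : linkProduct n (staircase n) =
    ∏ k ∈ Finset.range n, (MvPolynomial.X (2 * k + 1) - MvPolynomial.X (2 * k + 2)) := by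
  have hinj : Set.InjOn (fun k => (2 * k + 1, 2 * k + 2)) (Finset.range n : Set ℕ) := by
    intro x _ y _ hxy
    simp only [Prod.mk.injEq] at hxy
    omega
  have : (Finset.Icc 1 (2 * n) ×ˢ Finset.Icc 1 (2 * n)).filter
      (fun p => Linked n (staircase n) p.1 p.2) =
      (Finset.range n).image fun k => (2 * k + 1, 2 * k + 2) := by
    ext ⟨p, q⟩
    rw [mem_links, Finset.mem_image]
    simp only [Finset.mem_range, Prod.mk.injEq]
    constructor
    · rintro ⟨h1, h2⟩
      obtain ⟨k, hk, rfl, rfl⟩ := (linked_staircase_iff h1.1.1 h1.2.2).1 h2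
      exact ⟨k, hk, rfl, rfl⟩
    · rintro ⟨k, hk, rfl, rfl⟩
      exact ⟨by omega, (linked_staircase_iff (by omega) (by omega)).2 ⟨k, hk, rfl, rfl⟩⟩
  unfold linkProduct
  rw [this, Finset.prod_image hinj]

theorem isLKa_iff {n : ℕ} {lam : YoungDiagram} (hlam : lam ≤ staircase n) {f : Poly} :
    IsLKa n lam f ↔ f = linkProduct n lam := by
  constructor
  · intro h
    have key : lam ≤ staircase n ∧ f = linkProduct n lam := by
      clear hlam
      induction h with
      | base => exact ⟨le_rfl, (linkProduct_staircase n).symm⟩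
      | @step lam mu f c hf hc hins ih =>
        obtain ⟨hlam, rfl⟩ := ih
        exact ⟨(le_of_insert hins).trans hlam, linkProduct_insert hlam hc hins⟩
    exact key.2
  · rintro rfl
    refine staircase_induction (P := fun lam => IsLKa n lam (linkProduct n lam)) ?_ ?_ hlam
    · rw [linkProduct_staircase]; exact .base
    · intro lam mu c hlam hc hins ih
      rw [← linkProduct_insert hlam hc hins]
      exact .step ih hc hins

end HankelKL

theorem mainTheorem10 (n : ℕ) (lam mu : YoungDiagram)
    (hlam : lam ≤ HankelKL.staircase n) (hmu : mu ≤ HankelKL.staircase n) :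
    (∀ f : HankelKL.Poly, HankelKL.IsLKa n lam f ↔ f = HankelKL.linkProduct n lam) ∧
      ∀ f : HankelKL.Poly, HankelKL.IsLKa n lam f →
        HankelKL.pairing f (HankelKL.KLx n mu) = if lam = mu then 1 else 0 :=
  ⟨fun _ => HankelKL.isLKa_iff hlam, fun _ h => h.pairing_KLx hmu⟩
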